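/- **Setting.** Let $S$ and $A$ be finite lattices, $S$ non-empty with least element $\bot$ and $|A|\ge 2$. A mean field is a probability vector on $S$; a strategy $\mu$ assigns to each $s\in S$ a probability vector $\mu(s,\cdot)$ on $A$. A mean field game consists of rewards $r(s,a,z)$ with $|r|\le 1$, transition probabilities $P(\cdot\mid s,a,z)$, and a discount factor $\gamma\in[0,1)$. Fix $\epsilon\ge 0$ with $\epsilon/(|A|-1)<1-\epsilon$. A trembling-hand strategy plays, in each state, one action with probability $1-\epsilon$ and each other action with probability $\epsilon/(|A|-1)$. For $Q:S\times A\to\mathbb R$, $\pi^\epsilon_Q$ is the trembling-hand strategy that favours in state $s$ the supremum of $\arg\max_b Q(s,b)$ (or some maximizer, if this supremum is not a maximizer), and $G(Q)(s)=\sum_a\pi^\epsilon_Q(s,a)Q(s,a)$. Let $V^*_z(s)$ be the maximal expected $\gamma$-discounted reward from $s$ over the trembling-hand strategies, with $z$ frozen, and $Q^*_z(s,a)=r(s,a,z)+\gamma\sum_{s'}P(s'|s,a,z)V^*_z(s')$. Put $P_{z,\mu}(s'|s)=\sum_a\mu(s,a)P(s'|s,a,z)$ and $\Phi(z,\mu)(s')=\sum_s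 z(s)P_{z,\mu}(s'|s)$. A T-MFE is a pair $(z,\mu)$ with $\mu$ an optimal trembling-hand strategy for $z$ and $\Phi(z,\mu)=z$. Mean fields are ordered by first-order stochastic dominance. **Assumptions.** (SC) $r$ is non-decreasing in $s$, supermodular in $(s,a)$ and has increasing differences in $(s,a)$ and $z$; $P$ is stochastically non-decreasing in $s$, $a$ and $z$, stochastically supermodular in $(s,a)$, and has stochastically increasing differences in $(s,a)$ and $z$. (Lip) There are $C_1,C_2,C_3\ge 0$ such that for all $s,a,z,z',Q$ $$|r(s,a,z)-r(s,a,z')|\le C_1\|z-z'\|_1,\qquad \|P(\cdot|s,a,z)-P(\cdot|s,a,z')\|_1\le C_2\|z-z'\|_1,$$ $$\|P_{z,\mu}(\cdot|s)-P_{z,\mu'}(\cdot|s)\|_1\le C_3\|Q^*_{z'}-Q\|_\infty\quad\text{for }\mu=\pi^\epsilon_{Q^*_{z'}},\ \mu'=\pi^\epsilon_Q .$$ **Algorithms.** T-BR: $\bar z_0=\delta_\bot$ (the smallest mean field), $\bar z_{k+1}=\Phi(\bar z_k,\pi^\epsilon_{Q^*_{\bar z_k}})$. TMFQ-learning with exponent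 $w\in(1/2,1)$: $z_0=\delta_\bot$; in outer iteration $k$ one sets $Q_0=0$ and performs $T_0$ asynchronous steps $$Q_{t+1}(s_t,a_t)=(1-\alpha_t)Q_t(s_t,a_t)+\alpha_t\bigl(r(s_t,a_t,z_k)+\gamma G(Q_t)(s'_t)\bigr),\qquad \alpha_t=\frac1{(n_t(s_t,a_t)+1)^{w}},$$ where all other entries of $Q_t$ are left unchanged, $n_t(s,a)$ is the number of visits to $(s,a)$ before time $t$, the pair $(s_t,a_t)$ is chosen in any way from the past, and $s'_t\sim P(\cdot|s_t,a_t,z_k)$ given the past; then $\mu_k=\pi^\epsilon_{Q_{T_0}}$ and $z_{k+1}=\text{Next-MF}(z_k,\mu_k)$. Here Next-MF$(z,\mu)$ draws independent triples $s\sim z$, $a\sim\mu(s,\cdot)$, $s'\sim P(\cdot|s,a,z)$, their positive number being fixed by some stopping rule, and returns the empirical distribution of the $s'$. **Theorem.** For every $w\in(1/2,1)$ there is a constant $c=c(w)>0$ such that for every game satisfying (SC) and (Lip) the following holds. The T-BR mean fields $\bar z_k$ converge to a mean field $z^*$, and $(z^*,\pi^\epsilon_{Q^*_{z^*}})$ is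 a T-MFE. Let $0<\bar\epsilon,\delta<1$, let $k_0$ be such that $\|\bar z_{k_0}-z^*\|_1\le\bar\epsilon$, and put $$D=\frac{C_1}{1-\gamma}+\frac{\gamma C_2}{(1-\gamma)^2},\quad a=1+C_2+C_3D,\quad B=\max\Bigl\{a^{k_0+1},\ \sum_{j=0}^{k_0-1}a^j\Bigr\}(C_3+1),\quad V_{\max}=\frac1{1-\gamma},\quad \beta=\frac{1-\gamma}2$$ (so $B=(1+C_2+C_3D)^{k_0+1}(C_3+1)$ whenever $a\ge(1+\sqrt5)/2$). Suppose that Next-MF uses enough samples that, for all $z$ and $\mu$, its output is within $\bar\epsilon/B$ of $\Phi(z,\mu)$ in $\ell^1$ with probability at least $1-\delta/(2k_0)$; that in each iteration $k<k_0$, almost surely, every state-action pair is visited in every $L$ consecutive steps (covering time at most $L$); and that $$T_0\ \ge\ c\left[\left(\frac{L^{1+3w}V_{\max}^2B^2\ln\frac{2k_0|S||A|V_{\max}B}{\delta\beta\bar\epsilon}}{\beta^2\bar\epsilon^2}\right)^{1/w}+\left(\frac L\beta\ln\frac{V_{\max}B}{\bar\epsilon}\right)^{1/(1-w)}\right].$$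 Then $\mathbb P\bigl(\|z_{k_0}-z^*\|_1\le 2\bar\epsilon\bigr)\ge 1-\delta$. (For $k_0=0$ the last three conditions are not needed.) -/

import Mathlib

open MeasureTheory ProbabilityTheory Filter Topology

noncomputable section

namespace MFG

/-- The `ℓ¹` distance of two probability vectors. -/
def l1dist {S : Type*} [Fintype S] (z z' : stdSimplex ℝ S) : ℝ :=
  ∑ s, |z.1 s - z'.1 s|

/-- The point mass at `s`. -/
def pointMass {S : Type*} [Fintype S] [DecidableEq S] (s : S) : stdSimplex ℝ S :=
  ⟨Pi.single s 1, single_mem_stdSimplex ℝ s⟩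

/-- The expectation of `f` under the probability vector `z`. -/
def expect {S : Type*} [Fintype S] (z : stdSimplex ℝ S) (f : S → ℝ) : ℝ :=
  ∑ s, z.1 s * f s

/-- First-order stochastic dominance `z ⪯ z'`. -/
def SDLe {S : Type*} [Fintype S] [Preorder S] (z z' : stdSimplex ℝ S) : Prop :=
  ∀ f : S → ℝ, Monotone f → expect z f ≤ expect z' f

/-- Supermodular functions on a lattice. -/
def Supermodular {X : Type*} [Lattice X] (f : X → ℝ) : Prop :=
  ∀ x y, f x + f y ≤ f (x ⊔ y) + f (x ⊓ y)

/-- The set of maximizers of `f`. -/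
def maximizers {A : Type*} [Fintype A] (f : A → ℝ) : Finset A :=
  open Classical in Finset.univ.filter fun a => ∀ b, f b ≤ f a

theorem maximizers_nonempty {A : Type*} [Fintype A] [Nonempty A] (f : A → ℝ) :
    (maximizers f).Nonempty := by
  obtain ⟨a, ha⟩ := Finite.exists_max f
  exact ⟨a, by simpa [maximizers] using ha⟩

/-- The greedy action: the supremum of the set of maximizers. On a lattice that is not a chain this
supremum need not be a maximizer, and then an arbitrary maximizer is taken. -/
def greedy {A : Type*} [Fintype A] [Nonempty A] [Lattice A] (f : A → ℝ) : A :=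
  open Classical in
  if (maximizers f).sup' (maximizers_nonempty f) id ∈ maximizers f then
    (maximizers f).sup' (maximizers_nonempty f) id
  else (maximizers_nonempty f).choose

/-- A stationary mean field game with finite state space `S` and finite action space `A`: reward
`r`, transition kernel `P`, discount factor `γ`, and the trembling probability `ε`. -/
structure Game (S A : Type*) [Fintype S] [Fintype A] where
  r : S → A → stdSimplex ℝ S → ℝ
  P : S → A → stdSimplex ℝ S → stdSimplex ℝ S
  γ : ℝ
  ε : ℝ
  abs_r_le : ∀ s a z, |r s a z| ≤ 1
  γ_nonneg : 0 ≤ γ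
  γ_lt : γ < 1
  ε_nonneg : 0 ≤ ε
  ε_lt : ε / ((Fintype.card A : ℝ) - 1) < 1 - ε

/-- A (Markov, randomized) strategy. -/
abbrev Strategy (S A : Type*) [Fintype A] := S → stdSimplex ℝ A

namespace Game

variable {S A : Type*} [Fintype S] [DecidableEq S] [Lattice S]
  [Fintype A] [DecidableEq A] [Lattice A] [Nontrivial A] (M : Game S A)

/-- The trembling-hand strategy around the deterministic strategy `σ`: it plays `σ s` with
probability `1 - ε` and every other action with probability `ε / (|A| - 1)`. -/
def tremble (σ : S → A) : Strategy S A := fun s =>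
  ⟨fun a => if a = σ s then 1 - M.ε else M.ε / ((Fintype.card A : ℝ) - 1), by
    have h1 : (1 : ℝ) < Fintype.card A := by exact_mod_cast Fintype.one_lt_card
    have h2 : 0 ≤ M.ε / ((Fintype.card A : ℝ) - 1) := div_nonneg M.ε_nonneg (by linarith)
    refine ⟨fun a => ?_, ?_⟩
    · dsimp only
      split_ifs
      · exact h2.trans M.ε_lt.le
      · exact h2
    · rw [Finset.sum_ite, Finset.sum_const, Finset.sum_const, Finset.filter_eq' ,
        Finset.filter_ne']
      simp only [Finset.mem_univ, if_true, Finset.card_singleton, one_smul,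
        Finset.card_erase_of_mem, Finset.card_univ, nsmul_eq_mul]
      rw [Nat.cast_sub (by exact_mod_cast h1.le)]
      have h3 : (Fintype.card A : ℝ) - 1 ≠ 0 := by linarith
      push_cast
      field_simp
      ring⟩

/-- The trembling-hand strategy `π^ε_Q` of a Q-function. -/
def trembling (Q : S → A → ℝ) : Strategy S A :=
  M.tremble fun s => greedy (Q s)

/-- `G(Q)(s) = ∑_a π^ε_Q(s,a) Q(s,a)`. -/
def G (Q : S → A → ℝ) (s : S) : ℝ :=
  ∑ a, (M.trembling Q s).1 a * Q s a

/-- The state transition matrix `P_{z,μ}(s'|s)`. -/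
def kern (z : stdSimplex ℝ S) (μ : Strategy S A) : Matrix S S ℝ :=
  Matrix.of fun s s' => ∑ a, (μ s).1 a * (M.P s a z).1 s'

/-- The expected one-step reward of `μ` in state `s`. -/
def stepReward (z : stdSimplex ℝ S) (μ : Strategy S A) (s : S) : ℝ :=
  ∑ a, (μ s).1 a * M.r s a z

/-- The expected discounted reward of `μ` from state `s`, for a frozen mean field `z`. -/
def value (z : stdSimplex ℝ S) (μ : Strategy S A) (s : S) : ℝ :=
  ∑' t : ℕ, M.γ ^ t * ((M.kern z μ ^ t).mulVec (M.stepReward z μ)) s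

/-- The optimal value among trembling-hand strategies (a maximum over a finite set). -/
def optV (z : stdSimplex ℝ S) (s : S) : ℝ :=
  ⨆ σ : S → A, M.value z (M.tremble σ) s

/-- The optimal trembling-hand Q-function `Q^*_z`. -/
def optQ (z : stdSimplex ℝ S) (s : S) (a : A) : ℝ :=
  M.r s a z + M.γ * expect (M.P s a z) (M.optV z)

/-- The McKean-Vlasov update `Φ(z,μ)(s') = ∑_s ∑_a z(s) μ(s,a) P(s'|s,a,z)`. -/
def Phi (z : stdSimplex ℝ S) (μ : Strategy S A) : stdSimplex ℝ S :=
  ⟨fun s' => ∑ s, ∑ a, z.1 s * (μ s).1 a * (M.P s a z).1 s', by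
    refine ⟨fun s' => Finset.sum_nonneg fun s _ => Finset.sum_nonneg fun a _ =>
      mul_nonneg (mul_nonneg (z.2.1 s) ((μ s).2.1 a)) ((M.P s a z).2.1 s'), ?_⟩
    rw [Finset.sum_comm]
    have h : ∀ s, ∑ s', ∑ a, z.1 s * (μ s).1 a * (M.P s a z).1 s' = z.1 s := by
      intro s
      rw [Finset.sum_comm]
      simp only [← Finset.mul_sum, (M.P s _ z).2.2, mul_one, (μ s).2.2]
    simp only [h, z.2.2]⟩

/-- A trembling-hand-perfect mean field equilibrium: a trembling-hand strategy `μ` that is optimal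
for `z` among the trembling-hand strategies, together with a mean field `z` that it reproduces. -/
structure IsTMFE (z : stdSimplex ℝ S) (μ : Strategy S A) : Prop where
  trembling : ∃ σ : S → A, μ = M.tremble σ
  optimal : ∀ s, M.value z μ s = M.optV z s
  consistent : M.Phi z μ = z

/-- Strategic complementarities. -/
structure IsSC : Prop where
  reward_mono : ∀ a z, Monotone fun s => M.r s a z
  reward_supermodular : ∀ z, Supermodular fun x : S × A => M.r x.1 x.2 z
  reward_incDiff : ∀ z z', SDLe z z' →
    Monotone fun x : S × A => M.r x.1 x.2 z' - M.r x.1 x.2 z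
  trans_mono : ∀ z (f : S → ℝ), Monotone f →
    Monotone fun x : S × A => expect (M.P x.1 x.2 z) f
  trans_mono_field : ∀ s a z z', SDLe z z' → SDLe (M.P s a z) (M.P s a z')
  trans_supermodular : ∀ z (f : S → ℝ), Monotone f →
    Supermodular fun x : S × A => expect (M.P x.1 x.2 z) f
  trans_incDiff : ∀ z z', SDLe z z' → ∀ f : S → ℝ, Monotone f →
    Monotone fun x : S × A => expect (M.P x.1 x.2 z') f - expect (M.P x.1 x.2 z) f

/-- Lipschitz conditions on the reward and the transitions. The last one compares the transitions
under `π^ε_Q`, for an arbitrary `Q`, with those under an optimal trembling-hand strategy. -/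
structure IsLipschitz (C₁ C₂ C₃ : ℝ) : Prop where
  nonneg₁ : 0 ≤ C₁
  nonneg₂ : 0 ≤ C₂
  nonneg₃ : 0 ≤ C₃
  reward : ∀ s a z z', |M.r s a z - M.r s a z'| ≤ C₁ * l1dist z z'
  trans : ∀ s a z z', l1dist (M.P s a z) (M.P s a z') ≤ C₂ * l1dist z z'
  strategy : ∀ (z z' : stdSimplex ℝ S) (Q : S → A → ℝ) (s : S),
    ∑ s', |M.kern z (M.trembling (M.optQ z')) s s' - M.kern z (M.trembling Q) s s'|
      ≤ C₃ * ‖M.optQ z' - Q‖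

/-- The mean fields of the trembling best response dynamics `z ↦ Φ(z, π^ε_{Q^*_z})`, started at
the smallest distribution. -/
def tbr [OrderBot S] : ℕ → stdSimplex ℝ S
  | 0 => pointMass ⊥
  | k + 1 => M.Phi (tbr k) (M.trembling (M.optQ (tbr k)))

/-- The number of visits of `x` before time `t`. -/
def visits (pair : ℕ → S × A) (t : ℕ) (x : S × A) : ℕ :=
  ((Finset.range t).filter fun j => pair j = x).card

/-- Asynchronous Q-learning for the frozen mean field `z` with the polynomial learning rate
`1 / (n_t(s,a) + 1)^w`, along the visited pairs `pair` and the sampled next states `next`. -/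
def qIter (w : ℝ) (z : stdSimplex ℝ S) (pair : ℕ → S × A) (next : ℕ → S) : ℕ → S → A → ℝ
  | 0 => fun _ _ => 0
  | t + 1 => fun s a =>
      if (s, a) = pair t then
        (1 - 1 / ((visits pair t (s, a) : ℝ) + 1) ^ w) * qIter w z pair next t s a +
          1 / ((visits pair t (s, a) : ℝ) + 1) ^ w *
            (M.r s a z + M.γ * M.G (qIter w z pair next t) (next t))
      else qIter w z pair next t s a

variable [MeasurableSpace S] [MeasurableSpace A]

/-- The law of a triple `(s, a, s')` with `s ∼ z`, `a ∼ μ(s,·)`, `s' ∼ P(·|s,a,z)`. -/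
def drawLaw (z : stdSimplex ℝ S) (μ : Strategy S A) : Measure (S × A × S) :=
  ∑ x : S × A × S,
    ENNReal.ofReal (z.1 x.1 * (μ x.1).1 x.2.1 * (M.P x.1 x.2.1 z).1 x.2.2) • Measure.dirac x

instance isProbabilityMeasure_drawLaw (z : stdSimplex ℝ S) (μ : Strategy S A) :
    IsProbabilityMeasure (M.drawLaw z μ) := by
  constructor
  simp only [drawLaw, Measure.coe_finsetSum, Finset.sum_apply, Measure.smul_apply,
    measure_univ, smul_eq_mul, mul_one]
  rw [← ENNReal.ofReal_sum_of_nonneg fun x _ =>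
    mul_nonneg (mul_nonneg (z.2.1 _) ((μ x.1).2.1 _)) ((M.P x.1 x.2.1 z).2.1 _)]
  simp only [Fintype.sum_prod_type, ← Finset.mul_sum, (M.P _ _ z).2.2, mul_one, (μ _).2.2, z.2.2,
    ENNReal.ofReal_one]

/-- The law of a sequence of independent such triples. -/
def streamLaw (z : stdSimplex ℝ S) (μ : Strategy S A) : Measure (ℕ → S × A × S) :=
  Measure.infinitePi fun _ => M.drawLaw z μ

end Game

/-- The relative frequency of the next state `s` among the first `n` triples of `y`. -/
def freq {S A : Type*} [DecidableEq S] (y : ℕ → S × A × S) (n : ℕ) (s : S) : ℝ :=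
  (((Finset.range n).filter fun j => (y j).2.2 = s).card : ℝ) / n

/-- The rule that tells Next-MF when to stop sampling: `num y` is the (positive) number of triples
it uses, decided from the triples seen so far. A fixed number of samples is a constant rule. -/
structure StopRule (S A : Type*) [MeasurableSpace S] [MeasurableSpace A] where
  num : (ℕ → S × A × S) → ℕ
  measurable_num : Measurable num
  num_pos : ∀ y, 0 < num y
  stopping : ∀ y y', (∀ j < num y, y j = y' j) → num y' = num y

namespace Game

variable {S A : Type*} [Fintype S] [DecidableEq S] [Lattice S] [OrderBot S]
  [Fintype A] [DecidableEq A] [Lattice A] [Nontrivial A]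
  [MeasurableSpace S] [MeasurableSpace A] (M : Game S A)

/-- For every `z` and `μ`, the mean field that Next-MF returns is within `e` of `Φ(z,μ)` with
probability at least `1 - d`. -/
def NextMFAccurate (τ : StopRule S A) (e d : ℝ) : Prop :=
  ∀ (z : stdSimplex ℝ S) (μ : Strategy S A),
    1 - d ≤ (M.streamLaw z μ).real {y | ∑ s, |freq y (τ.num y) s - (M.Phi z μ).1 s| ≤ e}

/-- A run of TMFQ-learning on a probability space `(Ω, Pr)`. Outer iteration `k` freezes the mean
field `z k`, performs `T₀` steps of Q-learning, takes the trembling-hand strategy of the result, and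
obtains `z (k + 1)` from Next-MF. The information available in iteration `k` after `t` steps
is `ℱ k t`; the pair to be visited at step `t` may be chosen in any way from that information (for
instance along a trajectory, or by querying a simulator). -/
structure Run (w : ℝ) (T₀ : ℕ) (τ : StopRule S A) {Ω : Type*} [mΩ : MeasurableSpace Ω]
    (Pr : Measure Ω) where
  ℱ : ℕ → Filtration ℕ mΩ
  z : ℕ → Ω → stdSimplex ℝ S
  pair : ℕ → ℕ → Ω → S × A
  next : ℕ → ℕ → Ω → S
  draws : ℕ → Ω → ℕ → S × A × S
  ℱ_succ : ∀ k, ℱ k T₀ ≤ ℱ (k + 1) 0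
  z_zero : ∀ ω, z 0 ω = pointMass ⊥
  measurable_z : ∀ k, Measurable[ℱ k 0] (z k)
  measurable_pair : ∀ k, ∀ t < T₀, Measurable[ℱ k t] (pair k t)
  measurable_next : ∀ k, ∀ t < T₀, Measurable[ℱ k (t + 1)] (next k t)
  next_law : ∀ k, ∀ t < T₀, ∀ s' : S,
    Pr⟦next k t ⁻¹' {s'} | ℱ k t⟧ =ᵐ[Pr]
      fun ω => (M.P (pair k t ω).1 (pair k t ω).2 (z k ω)).1 s'
  measurable_draws : ∀ k, Measurable (draws k)
  draws_law : ∀ k, ∀ E : Set (ℕ → S × A × S), MeasurableSet E →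
    Pr⟦draws k ⁻¹' E | ℱ k T₀⟧ =ᵐ[Pr]
      fun ω => (M.streamLaw (z k ω) (M.trembling
        (M.qIter w (z k ω) (fun t => pair k t ω) (fun t => next k t ω) T₀))).real E
  z_succ : ∀ k ω s, (z (k + 1) ω).1 s = freq (draws k ω) (τ.num (draws k ω)) s

/-- In iteration `k`, the covering time of the sequence of visited pairs is at most `L`: from every
time on, all state-action pairs are visited within `L` steps. -/
def Run.CoveredWithin {M : Game S A} {w : ℝ} {T₀ : ℕ} {τ : StopRule S A} {Ω : Type*}
    [MeasurableSpace Ω] {Pr : Measure Ω} (R : M.Run w T₀ τ Pr) (k L : ℕ) : Prop :=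
  ∀ᵐ ω ∂Pr, ∀ t, t + L ≤ T₀ → ∀ x : S × A, ∃ j, t ≤ j ∧ j < t + L ∧ R.pair k j ω = x

end Game

/-- `D = C₁ / (1 - γ) + γ C₂ / (1 - γ)²`. -/
def constD (γ C₁ C₂ : ℝ) : ℝ := C₁ / (1 - γ) + γ * C₂ / (1 - γ) ^ 2

/-- `B = max (a ^ (k₀ + 1)) (1 + a + ⋯ + a ^ (k₀ - 1)) * (C₃ + 1)` with `a = 1 + C₂ + C₃ D`; the
maximum is its first entry if `a ≥ (1 + √5) / 2`. -/
def constB (γ C₁ C₂ C₃ : ℝ) (k₀ : ℕ) : ℝ :=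
  max ((1 + C₂ + C₃ * constD γ C₁ C₂) ^ (k₀ + 1))
    (∑ j ∈ Finset.range k₀, (1 + C₂ + C₃ * constD γ C₁ C₂) ^ j) * (C₃ + 1)

/-- The number of Q-learning steps, up to a constant factor: with `V = 1 / (1 - γ)` and
`β = (1 - γ) / 2`, for `n` state-action pairs, accuracy `e` and failure probability `d`,
`(L^(1+3w) V² ln(n V / (d β e)) / (β² e²))^(1/w) + ((L / β) ln(V / e))^(1/(1-w))`. -/
def qSteps (w γ : ℝ) (n L : ℕ) (e d : ℝ) : ℝ :=
  ((L : ℝ) ^ (1 + 3 * w) * (1 / (1 - γ)) ^ 2 *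
      Real.log (n * (1 / (1 - γ)) / (d * ((1 - γ) / 2) * e)) /
        (((1 - γ) / 2) ^ 2 * e ^ 2)) ^ (1 / w) +
    ((L : ℝ) / ((1 - γ) / 2) * Real.log (1 / (1 - γ) / e)) ^ (1 / (1 - w))

end MFG

end

/-! With the mean field frozen, a player faces a discounted control problem. The favoured action
carries more weight than each other one, so favouring a maximizer is the best tremble, `G` is a
maximum of averages, and the Bellman operator `bell` is a contraction. Its fixed point is `optV`,
attained in all states at once by the tremble around the greedy actions (`optV_eq_bellFix`).

Convergence of T-BR is monotone comparative statics. Value iteration from 0 preserves monotonicity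
in the state and increasing differences in state and field. In the limit `optQ` is supermodular and
its greedy action increases with state and field (`IsSC.greedy_optQ_le`). So the best response map
preserves stochastic dominance, the orbit of the least mean field increases, and it converges
(`exists_tendsto_of_sdle`). The Lipschitz conditions make the map continuous, so the limit is a
fixed point, that is, an equilibrium.

The learning run is a perturbed copy of this orbit. One step multiplies the distance to T-BR by at
most `a = 1 + C₂ + C₃ D` and adds `C₃` times the Q-learning error plus the sampling error. If both
errors are at most `εbar / B`, the geometric sum stays below `εbar` up to step `k₀`
(`IsLipschitz.l1dist_tbr_le`). There are `2 k₀` failure events, each with probability at most `δ /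
(2 k₀)`.

For Q-learning, the error at time `t` is split into an averaged martingale noise (`noiseAvg`) and a
remainder (`drift`). After `n` visits the squared weights of the noise sum to at most `n ^ (-w)`, so
Azuma–Hoeffding gives a tail `exp (-const * u² n ^ w)`, summable over visit numbers; a union bound
over pairs and visit numbers makes the noise uniformly small after a burn-in. From then on each
phase of `L * m` steps, with `m ≥ T ^ w`, multiplies the error by `1 - β`, up to the noise. Burn-in
and phases must fit into `T₀`: these are the two terms of `qSteps` (`exists_const_qSteps`). -/

noncomputable section

set_option linter.unusedSectionVars false

namespace MFG

/-! ### Expectations under probability vectors -/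

section Expect

variable {S : Type*} [Fintype S]

theorem expect_le_expect (z : stdSimplex ℝ S) {f g : S → ℝ} (h : ∀ s, f s ≤ g s) :
    expect z f ≤ expect z g :=
  Finset.sum_le_sum fun s _ => mul_le_mul_of_nonneg_left (h s) (z.2.1 s)

theorem expect_const (z : stdSimplex ℝ S) (c : ℝ) : expect z (fun _ => c) = c := by
  simp [expect, ← Finset.sum_mul, z.2.2]

theorem expect_sub (z : stdSimplex ℝ S) (f g : S → ℝ) :
    expect z f - expect z g = expect z fun s => f s - g s := by
  simp [expect, mul_sub]

theorem abs_expect_le (z : stdSimplex ℝ S) {f : S → ℝ} {c : ℝ} (h : ∀ s, |f s| ≤ c) :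
    |expect z f| ≤ c := by
  rw [abs_le]
  constructor
  · have := expect_le_expect z (f := fun _ => -c) (g := f) fun s => (abs_le.1 (h s)).1
    rwa [expect_const] at this
  · have := expect_le_expect z (f := f) (g := fun _ => c) fun s => (abs_le.1 (h s)).2
    rwa [expect_const] at this

theorem abs_expect_sub_expect_le (z : stdSimplex ℝ S) {f g : S → ℝ} {c : ℝ}
    (h : ∀ s, |f s - g s| ≤ c) : |expect z f - expect z g| ≤ c := by
  rw [expect_sub]
  exact abs_expect_le z h

theorem abs_expect_sub_le_l1dist (z z' : stdSimplex ℝ S) {f : S → ℝ} {c : ℝ}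
    (h : ∀ s, |f s| ≤ c) : |expect z f - expect z' f| ≤ c * l1dist z z' := by
  rw [expect, expect, ← Finset.sum_sub_distrib, l1dist, Finset.mul_sum]
  refine (Finset.abs_sum_le_sum_abs _ _).trans (Finset.sum_le_sum fun s _ => ?_)
  rw [← sub_mul, abs_mul, mul_comm]
  exact mul_le_mul_of_nonneg_right (h s) (abs_nonneg _)

end Expect

theorem le_greedy {A : Type*} [Fintype A] [Nonempty A] [Lattice A] (f : A → ℝ) (b : A) :
    f b ≤ f (greedy f) := by
  classical
  have h : greedy f ∈ maximizers f := by
    unfold greedy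
    split_ifs with h
    · exact h
    · exact (maximizers_nonempty f).choose_spec
  simp only [maximizers, Finset.mem_filter, Finset.mem_univ, true_and] at h
  exact h b

/-! ### Dynamic programming for a frozen mean field -/

namespace Game

variable {S A : Type*} [Fintype S] [DecidableEq S] [Lattice S]
  [Fintype A] [DecidableEq A] [Lattice A] [Nontrivial A] (M : Game S A)

/-- The probability of each action that a trembling-hand strategy does not favour. -/
def tremor : ℝ := M.ε / ((Fintype.card A : ℝ) - 1)

theorem tremor_nonneg : 0 ≤ M.tremor := by
  have h1 : (1 : ℝ) < Fintype.card A := by exact_mod_cast Fintype.one_lt_card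
  exact div_nonneg M.ε_nonneg (by linarith)

/-- A tremble is a uniform part that does not depend on `σ` plus a positive multiple of the point
mass at `σ s`. Comparisons of trembling averages thereby reduce to comparisons at the favoured
action. -/
theorem sum_tremble_mul (σ : S → A) (s : S) (f : A → ℝ) :
    ∑ a, (M.tremble σ s).1 a * f a
      = M.tremor * ∑ a, f a + (1 - M.ε - M.tremor) * f (σ s) := by
  have : ∀ a, (M.tremble σ s).1 a * f a
      = M.tremor * f a + if a = σ s then (1 - M.ε - M.tremor) * f a else 0 := by
    intro a
    simp only [tremble, tremor]
    split_ifs <;> ring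
  simp only [this, Finset.sum_add_distrib, ← Finset.mul_sum, Finset.sum_ite_eq', Finset.mem_univ,
    if_true]

theorem G_eq (Q : S → A → ℝ) (s : S) :
    M.G Q s = M.tremor * ∑ a, Q s a + (1 - M.ε - M.tremor) * Q s (greedy (Q s)) :=
  M.sum_tremble_mul _ s (Q s)

theorem sum_tremble_le_G (σ : S → A) (Q : S → A → ℝ) (s : S) :
    ∑ a, (M.tremble σ s).1 a * Q s a ≤ M.G Q s := by
  rw [G_eq, sum_tremble_mul]
  have := mul_le_mul_of_nonneg_left (le_greedy (Q s) (σ s))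
    (show 0 ≤ 1 - M.ε - M.tremor from sub_nonneg.2 M.ε_lt.le)
  linarith

/-- Since `G Q'` dominates every trembling average of `Q'`, it can be compared with the one that
favours the greedy action of `Q`; both sides are then averages with the same weights. -/
theorem G_sub_G_le {Q Q' : S → A → ℝ} {s : S} {c : ℝ} (h : ∀ a, Q s a - Q' s a ≤ c) :
    M.G Q s - M.G Q' s ≤ c := by
  have h1 := M.sum_tremble_le_G (fun s => greedy (Q s)) Q' s
  have h2 : M.G Q s - ∑ a, (M.trembling Q s).1 a * Q' s a ≤ c := by
    rw [G, ← Finset.sum_sub_distrib]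
    simp only [← mul_sub]
    calc _ ≤ ∑ a, (M.trembling Q s).1 a * c := Finset.sum_le_sum fun a _ =>
          mul_le_mul_of_nonneg_left (h a) ((M.trembling Q s).2.1 a)
      _ = c := by rw [← Finset.sum_mul, (M.trembling Q s).2.2, one_mul]
  have h3 : ∑ a, (M.trembling Q s).1 a * Q' s a ≤ M.G Q' s := h1
  linarith

theorem abs_G_sub_G_le {Q Q' : S → A → ℝ} {s : S} {c : ℝ} (h : ∀ a, |Q s a - Q' s a| ≤ c) :
    |M.G Q s - M.G Q' s| ≤ c := by
  rw [abs_le]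
  constructor
  · have := M.G_sub_G_le (Q := Q') (Q' := Q) (s := s) (c := c) fun a => by
      have := (abs_le.1 (h a)).1
      linarith
    linarith
  · exact M.G_sub_G_le fun a => (abs_le.1 (h a)).2

theorem abs_G_le {Q : S → A → ℝ} {s : S} {c : ℝ} (h : ∀ a, |Q s a| ≤ c) : |M.G Q s| ≤ c := by
  have := M.abs_G_sub_G_le (Q := Q) (Q' := fun _ _ => 0) (s := s) (c := c) (by simpa using h)
  simpa [G] using this

/-- The Q-function of the continuation value `V`. -/
def qOf (z : stdSimplex ℝ S) (V : S → ℝ) (s : S) (a : A) : ℝ :=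
  M.r s a z + M.γ * expect (M.P s a z) V

/-- The Bellman operator of the trembling-hand control problem. -/
def bell (z : stdSimplex ℝ S) (V : S → ℝ) : S → ℝ := M.G (M.qOf z V)

/-- The bound `1 / (1 - γ)` on all values. -/
def vmax : ℝ := 1 / (1 - M.γ)

theorem one_add_γ_mul_vmax : 1 + M.γ * M.vmax = M.vmax := by
  have : 1 - M.γ ≠ 0 := by linarith [M.γ_lt]
  unfold vmax
  field_simp
  ring

theorem one_le_vmax : 1 ≤ M.vmax := by
  unfold vmax
  rw [le_div_iff₀ (by linarith [M.γ_lt])]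
  linarith [M.γ_nonneg]

theorem abs_qOf_sub_le (z : stdSimplex ℝ S) {V V' : S → ℝ} {c : ℝ} (h : ∀ s, |V s - V' s| ≤ c)
    (s : S) (a : A) : |M.qOf z V s a - M.qOf z V' s a| ≤ M.γ * c := by
  have : M.qOf z V s a - M.qOf z V' s a
      = M.γ * (expect (M.P s a z) V - expect (M.P s a z) V') := by
    simp only [qOf]; ring
  rw [this, abs_mul, abs_of_nonneg M.γ_nonneg]
  exact mul_le_mul_of_nonneg_left (abs_expect_sub_expect_le _ h) M.γ_nonneg

theorem abs_qOf_le (z : stdSimplex ℝ S) {V : S → ℝ} (h : ∀ s, |V s| ≤ M.vmax)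
    (s : S) (a : A) : |M.qOf z V s a| ≤ M.vmax := by
  rw [← one_add_γ_mul_vmax]
  refine (abs_add_le _ _).trans (add_le_add (M.abs_r_le s a z) ?_)
  rw [abs_mul, abs_of_nonneg M.γ_nonneg]
  exact mul_le_mul_of_nonneg_left (abs_expect_le _ h) M.γ_nonneg

theorem contractingWith_bell (z : stdSimplex ℝ S) :
    ContractingWith M.γ.toNNReal (M.bell z) := by
  refine ⟨by simpa using M.γ_lt, LipschitzWith.of_dist_le_mul fun V V' => ?_⟩
  rw [Real.coe_toNNReal _ M.γ_nonneg, dist_pi_le_iff (mul_nonneg M.γ_nonneg dist_nonneg)]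
  intro s
  rw [Real.dist_eq]
  refine M.abs_G_sub_G_le fun a => M.abs_qOf_sub_le z (fun s' => ?_) s a
  rw [← Real.dist_eq]
  exact dist_le_pi_dist V V' s'

theorem kern_mulVec (z : stdSimplex ℝ S) (μ : Strategy S A) (v : S → ℝ) (s : S) :
    (M.kern z μ).mulVec v s = ∑ a, (μ s).1 a * expect (M.P s a z) v := by
  simp only [Matrix.mulVec, dotProduct, kern, Matrix.of_apply, expect, Finset.sum_mul,
    Finset.mul_sum]
  rw [Finset.sum_comm]
  simp only [mul_assoc]

theorem abs_sum_strategy_le (μ : Strategy S A) (s : S) {f : A → ℝ} {c : ℝ} (h : ∀ a, |f a| ≤ c) :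
    |∑ a, (μ s).1 a * f a| ≤ c :=
  abs_expect_le (μ s) h

theorem abs_kern_pow_mulVec_le (z : stdSimplex ℝ S) (μ : Strategy S A) (t : ℕ) (s : S) :
    |((M.kern z μ ^ t).mulVec (M.stepReward z μ)) s| ≤ 1 := by
  induction t generalizing s with
  | zero =>
    simp only [pow_zero, Matrix.one_mulVec]
    exact abs_sum_strategy_le μ s fun a => M.abs_r_le s a z
  | succ t ih =>
    rw [pow_succ', ← Matrix.mulVec_mulVec, kern_mulVec]
    exact abs_sum_strategy_le μ s fun a => abs_expect_le _ ih

theorem summable_value (z : stdSimplex ℝ S) (μ : Strategy S A) (s : S) :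
    Summable fun t : ℕ => M.γ ^ t * ((M.kern z μ ^ t).mulVec (M.stepReward z μ)) s := by
  refine Summable.of_norm_bounded (summable_geometric_of_lt_one M.γ_nonneg M.γ_lt) fun t => ?_
  rw [Real.norm_eq_abs, abs_mul, abs_of_nonneg (pow_nonneg M.γ_nonneg t)]
  exact mul_le_of_le_one_right (pow_nonneg M.γ_nonneg t) (M.abs_kern_pow_mulVec_le z μ t s)

/-- The policy evaluation equation: the term `t = 0` of the series is split off and one factor of
the kernel is pulled out of the others. -/
theorem value_eq (z : stdSimplex ℝ S) (μ : Strategy S A) (s : S) :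
    M.value z μ s = ∑ a, (μ s).1 a * M.qOf z (M.value z μ) s a := by
  have h1 : ∑ a, (μ s).1 a * M.qOf z (M.value z μ) s a
      = M.stepReward z μ s + M.γ * (M.kern z μ).mulVec (M.value z μ) s := by
    rw [kern_mulVec, stepReward, Finset.mul_sum, ← Finset.sum_add_distrib]
    exact Finset.sum_congr rfl fun a _ => by simp only [qOf]; ring
  have h2 : (M.kern z μ).mulVec (M.value z μ) s
      = ∑' t : ℕ, M.γ ^ t * (M.kern z μ ^ (t + 1)).mulVec (M.stepReward z μ) s := by
    have h3 : ∀ t : ℕ, M.γ ^ t * (M.kern z μ ^ (t + 1)).mulVec (M.stepReward z μ) s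
        = ∑ s', M.kern z μ s s' * (M.γ ^ t * (M.kern z μ ^ t).mulVec (M.stepReward z μ) s') := by
      intro t
      rw [pow_succ', ← Matrix.mulVec_mulVec, Matrix.mulVec, dotProduct, Finset.mul_sum]
      exact Finset.sum_congr rfl fun s' _ => by ring
    simp only [h3]
    rw [Summable.tsum_finsetSum fun s' _ => (M.summable_value z μ s').mul_left _]
    simp only [tsum_mul_left]
    rfl
  rw [h1, h2, value, (M.summable_value z μ s).tsum_eq_zero_add, ← tsum_mul_left]
  simp only [pow_zero, one_mul, Matrix.one_mulVec]
  congr 1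
  exact tsum_congr fun t => by ring

/-- The fixed point of the Bellman operator. -/
def bellFix (z : stdSimplex ℝ S) : S → ℝ :=
  (M.contractingWith_bell z).fixedPoint

theorem bell_bellFix (z : stdSimplex ℝ S) : M.bell z (M.bellFix z) = M.bellFix z :=
  (M.contractingWith_bell z).fixedPoint_isFixedPt

theorem value_tremble_le_bellFix [Nonempty S] (z : stdSimplex ℝ S) (σ : S → A) (s : S) :
    M.value z (M.tremble σ) s ≤ M.bellFix z s := by
  set v := M.value z (M.tremble σ)
  -- Maximum principle: at the state with the largest excess, the Bellman inequality bounds the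
  -- excess by `γ` times itself, so it is nonpositive.
  obtain ⟨s₀, hs₀⟩ := Finite.exists_max fun s => v s - M.bellFix z s
  have h1 : M.bellFix z s₀ = M.G (M.qOf z (M.bellFix z)) s₀ := (congrFun (M.bell_bellFix z) s₀).symm
  have h2 : v s₀ ≤ M.G (M.qOf z v) s₀ :=
    (M.value_eq z _ s₀).trans_le (M.sum_tremble_le_G σ (M.qOf z v) s₀)
  have h3 : M.G (M.qOf z v) s₀ - M.G (M.qOf z (M.bellFix z)) s₀
      ≤ M.γ * (v s₀ - M.bellFix z s₀) := by
    refine M.G_sub_G_le fun a => ?_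
    have : M.qOf z v s₀ a - M.qOf z (M.bellFix z) s₀ a
        = M.γ * (expect (M.P s₀ a z) v - expect (M.P s₀ a z) (M.bellFix z)) := by
      simp only [qOf]; ring
    rw [this]
    refine mul_le_mul_of_nonneg_left ?_ M.γ_nonneg
    rw [expect_sub]
    refine (expect_le_expect _ hs₀).trans_eq (expect_const _ _)
  have h4 : v s₀ - M.bellFix z s₀ ≤ 0 := by
    by_contra hc
    push Not at hc
    nlinarith [M.γ_lt]
  linarith [hs₀ s]

theorem value_trembling_bellFix (z : stdSimplex ℝ S) :
    M.value z (M.trembling (M.qOf z (M.bellFix z))) = M.bellFix z := by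
  set μ := M.trembling (M.qOf z (M.bellFix z))
  funext s
  have : Nonempty S := ⟨s⟩
  obtain ⟨s₀, hs₀⟩ := Finite.exists_max fun s => |M.value z μ s - M.bellFix z s|
  have h1 : M.bellFix z s₀ = ∑ a, (μ s₀).1 a * M.qOf z (M.bellFix z) s₀ a :=
    (congrFun (M.bell_bellFix z) s₀).symm
  have h2 : |M.value z μ s₀ - M.bellFix z s₀| ≤ M.γ * |M.value z μ s₀ - M.bellFix z s₀| := by
    conv_lhs => rw [M.value_eq, h1]
    exact abs_expect_sub_expect_le (μ s₀) fun a => M.abs_qOf_sub_le z hs₀ s₀ a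
  have h3 : |M.value z μ s₀ - M.bellFix z s₀| ≤ 0 := by
    by_contra hc
    push Not at hc
    nlinarith [M.γ_lt]
  have := (hs₀ s).trans h3
  exact sub_eq_zero.1 (abs_nonpos_iff.1 this)

theorem optV_eq_bellFix (z : stdSimplex ℝ S) : M.optV z = M.bellFix z := by
  funext s
  have : Nonempty S := ⟨s⟩
  refine le_antisymm (ciSup_le fun σ => M.value_tremble_le_bellFix z σ s) ?_
  conv_lhs => rw [← M.value_trembling_bellFix z]
  exact le_ciSup (f := fun σ => M.value z (M.tremble σ) s) (Set.finite_range _).bddAbove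
    (fun s => greedy (M.qOf z (M.bellFix z) s))

theorem G_optQ (z : stdSimplex ℝ S) : M.G (M.optQ z) = M.optV z := by
  have := M.bell_bellFix z
  rwa [← optV_eq_bellFix] at this

theorem value_trembling_optQ (z : stdSimplex ℝ S) :
    M.value z (M.trembling (M.optQ z)) = M.optV z := by
  have := M.value_trembling_bellFix z
  rwa [← optV_eq_bellFix] at this

/-- Closed properties of `optV` (bounds, monotonicity, increasing differences) follow by checking
them along value iteration from 0. -/
theorem tendsto_iterate_bell (z : stdSimplex ℝ S) :
    Tendsto (fun n => (M.bell z)^[n] 0) atTop (𝓝 (M.optV z)) := by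
  rw [optV_eq_bellFix]
  exact (M.contractingWith_bell z).tendsto_iterate_fixedPoint 0

theorem abs_optV_le (z : stdSimplex ℝ S) (s : S) : |M.optV z s| ≤ M.vmax := by
  have h : ∀ n s, |(M.bell z)^[n] 0 s| ≤ M.vmax := by
    intro n
    induction n with
    | zero => intro s; simpa using zero_le_one.trans M.one_le_vmax
    | succ n ih =>
      intro s
      rw [Function.iterate_succ_apply']
      exact M.abs_G_le fun a => M.abs_qOf_le z ih s a
  exact le_of_tendsto ((tendsto_pi_nhds.1 (M.tendsto_iterate_bell z) s).abs)
    (Eventually.of_forall fun n => h n s)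

theorem abs_optQ_le (z : stdSimplex ℝ S) (s : S) (a : A) : |M.optQ z s a| ≤ M.vmax :=
  M.abs_qOf_le z (M.abs_optV_le z) s a

end Game

/-! ### Comparative statics of the greedy action -/

section Greedy

variable {A : Type*} [Fintype A] [Nonempty A] [Lattice A]

theorem mem_maximizers {f : A → ℝ} {a : A} : a ∈ maximizers f ↔ ∀ b, f b ≤ f a := by
  simp [maximizers]

/-- The greedy action of a supermodular function is its greatest maximizer. -/
theorem le_greedy_of_mem_maximizers {f : A → ℝ} (hf : Supermodular f) {a : A}
    (ha : a ∈ maximizers f) : a ≤ greedy f := by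
  have h : (maximizers f).sup' (maximizers_nonempty f) id ∈ maximizers f := by
    refine Finset.sup'_induction (p := fun a => a ∈ maximizers f) _ _ ?_ fun a ha => ha
    intro a ha b hb
    rw [mem_maximizers] at ha hb ⊢
    intro c
    linarith [hf a b, ha c, hb (a ⊓ b)]
  rw [greedy, if_pos h]
  exact Finset.le_sup' id ha

/-- Topkis' argument: passing from `greedy f` to its meet with `greedy g` cannot raise `f`, so by
`h` passing from `greedy g` to the join cannot lower `g`. The join is then a maximizer of `g`, and
lies below the greatest one. -/
theorem greedy_le_greedy {f g : A → ℝ} (hg : Supermodular g)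
    (h : ∀ a b, f a + g b ≤ f (a ⊓ b) + g (a ⊔ b)) : greedy f ≤ greedy g := by
  have h1 : greedy f ⊔ greedy g ∈ maximizers g := by
    rw [mem_maximizers]
    intro b
    linarith [h (greedy f) (greedy g), le_greedy f (greedy f ⊓ greedy g), le_greedy g b]
  exact le_sup_left.trans (le_greedy_of_mem_maximizers hg h1)

end Greedy

/-! ### Stochastic dominance and the ℓ¹ distance -/

section Dominance

variable {S : Type*} [Fintype S]

theorem SDLe.refl [Preorder S] (z : stdSimplex ℝ S) : SDLe z z := fun _ _ => le_rfl

theorem pointMass_bot_sdle [DecidableEq S] [Lattice S] [OrderBot S] (z : stdSimplex ℝ S) :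
    SDLe (pointMass ⊥) z := by
  intro f hf
  have h1 : expect (pointMass (⊥ : S)) f = f ⊥ := by simp [expect, pointMass, Pi.single_apply]
  rw [h1, ← expect_const z (f ⊥)]
  exact expect_le_expect z fun s => hf bot_le

/-- Both indicators are monotone, so convergence of the expectations of monotone functions forces
convergence of each coordinate. -/
theorem apply_eq_expect_sub_expect [PartialOrder S] (z : stdSimplex ℝ S) (s : S) :
    z.1 s = expect z ((Set.Ici s).indicator 1) - expect z ((Set.Ioi s).indicator 1) := by
  classical
  rw [expect_sub, expect, Finset.sum_eq_single s]
  · simp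
  · intro t _ ht
    by_cases h : s ≤ t
    · have h' : s < t := lt_of_le_of_ne h ht.symm
      simp [Set.indicator, h, h']
    · have h' : ¬ s < t := fun h' => h h'.le
      simp [Set.indicator, h, h']
  · simp

/-- A sequence of probability vectors that increases in stochastic dominance converges. -/
theorem exists_tendsto_of_sdle [PartialOrder S] {z : ℕ → stdSimplex ℝ S}
    (hz : ∀ k, SDLe (z k) (z (k + 1))) : ∃ z', Tendsto z atTop (𝓝 z') := by
  classical
  have h1 : ∀ f : S → ℝ, Monotone f → ∃ l, Tendsto (fun k => expect (z k) f) atTop (𝓝 l) := by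
    intro f hf
    refine ⟨_, tendsto_atTop_ciSup (monotone_nat_of_le_succ fun k => hz k f hf) ?_⟩
    refine ⟨‖f‖, ?_⟩
    rintro _ ⟨k, rfl⟩
    exact (abs_le.1 (abs_expect_le (z k) fun s => norm_le_pi_norm f s)).2
  have h2 : ∀ s, ∃ l, Tendsto (fun k => (z k).1 s) atTop (𝓝 l) := by
    intro s
    obtain ⟨l, hl⟩ := h1 ((Set.Ici s).indicator 1) (by
      intro a b hab
      by_cases h : s ≤ a
      · have h' := h.trans hab
        simp [Set.indicator, h, h']
      · simp only [Set.indicator, Set.mem_Ici, h, if_false]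
        split_ifs <;> simp)
    obtain ⟨l', hl'⟩ := h1 ((Set.Ioi s).indicator 1) (by
      intro a b hab
      by_cases h : s < a
      · have h' := h.trans_le hab
        simp [Set.indicator, h, h']
      · simp only [Set.indicator, Set.mem_Ioi, h, if_false]
        split_ifs <;> simp)
    refine ⟨l - l', ?_⟩
    simp only [apply_eq_expect_sub_expect (z _) s]
    exact hl.sub hl'
  choose l hl using h2
  have h3 : Tendsto (fun k => (z k).1) atTop (𝓝 l) := tendsto_pi_nhds.2 hl
  have h4 : l ∈ stdSimplex ℝ S :=
    (isClosed_stdSimplex ℝ S).mem_of_tendsto h3 (Eventually.of_forall fun k => (z k).2)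
  exact ⟨⟨l, h4⟩, tendsto_subtype_rng.2 h3⟩

theorem l1dist_nonneg (z z' : stdSimplex ℝ S) : 0 ≤ l1dist z z' :=
  Finset.sum_nonneg fun _ _ => abs_nonneg _

theorem l1dist_comm (z z' : stdSimplex ℝ S) : l1dist z z' = l1dist z' z :=
  Finset.sum_congr rfl fun _ _ => abs_sub_comm _ _

theorem l1dist_self (z : stdSimplex ℝ S) : l1dist z z = 0 := by simp [l1dist]

theorem l1dist_triangle (x y z : stdSimplex ℝ S) : l1dist x z ≤ l1dist x y + l1dist y z := by
  rw [l1dist, l1dist, l1dist, ← Finset.sum_add_distrib]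
  exact Finset.sum_le_sum fun s _ => abs_sub_le _ _ _

theorem eq_of_l1dist_le_zero {x y : stdSimplex ℝ S} (h : l1dist x y ≤ 0) : x = y := by
  have h1 : ∑ s, |x.1 s - y.1 s| = 0 := le_antisymm h (l1dist_nonneg x y)
  rw [Finset.sum_eq_zero_iff_of_nonneg fun _ _ => abs_nonneg _] at h1
  ext s
  exact sub_eq_zero.1 (abs_eq_zero.1 (h1 s (Finset.mem_univ s)))

theorem continuous_l1dist_left (z : stdSimplex ℝ S) : Continuous fun z' => l1dist z' z := by
  unfold l1dist
  refine continuous_finsetSum _ fun s _ => ?_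
  exact (((continuous_apply s).comp continuous_subtype_val).sub continuous_const).abs

/-- A function on the simplex that is Lipschitz for the `ℓ¹` distance is continuous. -/
theorem continuous_of_abs_sub_le_l1dist {f : stdSimplex ℝ S → ℝ} {C : ℝ}
    (h : ∀ z z', |f z - f z'| ≤ C * l1dist z z') : Continuous f := by
  rw [continuous_iff_continuousAt]
  intro z
  rw [ContinuousAt, tendsto_iff_dist_tendsto_zero]
  have h1 : Tendsto (fun z' => C * l1dist z' z) (𝓝 z) (𝓝 0) := by
    have := ((continuous_l1dist_left z).tendsto z).const_mul C
    rwa [l1dist_self, mul_zero] at this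
  exact squeeze_zero (fun _ => dist_nonneg) (fun z' => h z' z) h1

end Dominance

namespace Game

variable {S A : Type*} [Fintype S] [DecidableEq S] [Lattice S]
  [Fintype A] [DecidableEq A] [Lattice A] [Nontrivial A] {M : Game S A}

/-! ### Strategic complementarities and monotonicity of the best response -/

section Complementarities

theorem G_le_G {Q Q' : S → A → ℝ} {s s' : S} (h : ∀ a, Q s a ≤ Q' s' a) : M.G Q s ≤ M.G Q' s' := by
  rw [G_eq, G_eq]
  have h1 := mul_le_mul_of_nonneg_left (Finset.sum_le_sum fun a (_ : a ∈ Finset.univ) => h a)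
    M.tremor_nonneg
  have h2 := mul_le_mul_of_nonneg_left ((h (greedy (Q s))).trans (le_greedy (Q' s') _))
    (show 0 ≤ 1 - M.ε - M.tremor from sub_nonneg.2 M.ε_lt.le)
  exact add_le_add h1 h2

theorem IsSC.monotone_bell (hM : M.IsSC) (z : stdSimplex ℝ S) {V : S → ℝ} (hV : Monotone V) :
    Monotone (M.bell z V) := by
  intro s s' hs
  refine G_le_G fun a => add_le_add (hM.reward_mono a z hs) (mul_le_mul_of_nonneg_left ?_ M.γ_nonneg)
  exact hM.trans_mono z V hV (show (s, a) ≤ (s', a) from ⟨hs, le_rfl⟩)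

theorem IsSC.supermodular_qOf (hM : M.IsSC) (z : stdSimplex ℝ S) {V : S → ℝ} (hV : Monotone V) :
    Supermodular fun x : S × A => M.qOf z V x.1 x.2 := by
  intro x y
  have h1 := hM.reward_supermodular z x y
  have h2 := mul_le_mul_of_nonneg_left (hM.trans_supermodular z V hV x y) M.γ_nonneg
  simp only [qOf] at h1 h2 ⊢
  linarith

theorem IsSC.monotone_qOf_sub (hM : M.IsSC) {z z' : stdSimplex ℝ S} (hz : SDLe z z')
    {V V' : S → ℝ} (hV' : Monotone V') (hVV' : Monotone fun s => V' s - V s) :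
    Monotone fun x : S × A => M.qOf z' V' x.1 x.2 - M.qOf z V x.1 x.2 := by
  intro x y hxy
  have h1 := hM.reward_incDiff z z' hz hxy
  have h2 := hM.trans_incDiff z z' hz V' hV' hxy
  have h3 := hM.trans_mono z _ hVV' hxy
  simp only [← expect_sub] at h1 h2 h3
  -- The change of the continuation term is split as `(P' - P) V' + P (V' - V)`: the first part uses
  -- increasing differences of `P`, the second monotonicity of `P`.
  have h4 := mul_le_mul_of_nonneg_left (add_le_add h2 h3) M.γ_nonneg
  simp only [qOf]
  linarith

/-- Increasing differences survive maximization. The uniform part of the tremble is linear. For the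
maxima, the maximizers `a` of `Q' s` and `b` of `Q s'` are replaced by their join and meet:
supermodularity of `Q'` pays for the exchange, and monotonicity of `Q' - Q` between `(s, a ⊓ b)` and
`(s', b)` turns `Q'` into `Q` where needed. -/
theorem monotone_G_sub {Q Q' : S → A → ℝ} (hQ' : Supermodular fun x : S × A => Q' x.1 x.2)
    (hQ : Monotone fun x : S × A => Q' x.1 x.2 - Q x.1 x.2) :
    Monotone fun s => M.G Q' s - M.G Q s := by
  intro s s' hs
  have h1 : Q' s (greedy (Q' s)) + Q s' (greedy (Q s'))
      ≤ Q' s' (greedy (Q' s')) + Q s (greedy (Q s)) := by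
    set a := greedy (Q' s)
    set b := greedy (Q s')
    have h2 := hQ' (s, a) (s', b)
    have h3 := hQ (show (s, a ⊓ b) ≤ (s', b) from ⟨hs, inf_le_right⟩)
    simp only [Prod.mk_sup_mk, Prod.mk_inf_mk, sup_of_le_right hs, inf_of_le_left hs] at h2 h3
    linarith [le_greedy (Q' s') (a ⊔ b), le_greedy (Q s) (a ⊓ b)]
  have h4 : ∑ a, (Q' s a - Q s a) ≤ ∑ a, (Q' s' a - Q s' a) :=
    Finset.sum_le_sum fun a _ => hQ (show (s, a) ≤ (s', a) from ⟨hs, le_rfl⟩)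
  rw [Finset.sum_sub_distrib, Finset.sum_sub_distrib] at h4
  have h5 := mul_le_mul_of_nonneg_left h4 M.tremor_nonneg
  have h6 := mul_le_mul_of_nonneg_left h1
    (show 0 ≤ 1 - M.ε - M.tremor from sub_nonneg.2 M.ε_lt.le)
  simp only [G_eq]
  linarith

theorem IsSC.monotone_optV (hM : M.IsSC) (z : stdSimplex ℝ S) : Monotone (M.optV z) := by
  have h : ∀ n, Monotone ((M.bell z)^[n] 0) := by
    intro n
    induction n with
    | zero => exact monotone_const
    | succ n ih =>
      rw [Function.iterate_succ_apply']
      exact hM.monotone_bell z ih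
  intro s s' hs
  have h1 := tendsto_pi_nhds.1 (M.tendsto_iterate_bell z)
  exact le_of_tendsto_of_tendsto' (h1 s) (h1 s') fun n => h n hs

/-- The difference alone is not an inductive property of value iteration: its step also needs the
iterate for `z'` to be monotone, hence the joint invariant. -/
theorem IsSC.monotone_optV_sub (hM : M.IsSC) {z z' : stdSimplex ℝ S} (hz : SDLe z z') :
    Monotone fun s => M.optV z' s - M.optV z s := by
  have h : ∀ n, Monotone ((M.bell z)^[n] 0) ∧ Monotone ((M.bell z')^[n] 0) ∧
      Monotone fun s => (M.bell z')^[n] 0 s - (M.bell z)^[n] 0 s := by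
    intro n
    induction n with
    | zero => exact ⟨monotone_const, monotone_const, by simpa using monotone_const⟩
    | succ n ih =>
      simp only [Function.iterate_succ_apply']
      exact ⟨hM.monotone_bell z ih.1, hM.monotone_bell z' ih.2.1,
        monotone_G_sub (hM.supermodular_qOf z' ih.2.1) (hM.monotone_qOf_sub hz ih.2.1 ih.2.2)⟩
  intro s s' hs
  have h1 := tendsto_pi_nhds.1 (M.tendsto_iterate_bell z)
  have h2 := tendsto_pi_nhds.1 (M.tendsto_iterate_bell z')
  exact le_of_tendsto_of_tendsto' ((h2 s).sub (h1 s)) ((h2 s').sub (h1 s')) fun n => (h n).2.2 hs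

theorem IsSC.greedy_optQ_le (hM : M.IsSC) {z z' : stdSimplex ℝ S} (hz : SDLe z z') {s s' : S}
    (hs : s ≤ s') : greedy (M.optQ z s) ≤ greedy (M.optQ z' s') := by
  have h1 := hM.supermodular_qOf z' (hM.monotone_optV z')
  have h2 := hM.monotone_qOf_sub hz (hM.monotone_optV z') (hM.monotone_optV_sub hz)
  refine greedy_le_greedy (fun a b => ?_) fun a b => ?_
  · have := h1 (s', a) (s', b)
    simp only [Prod.mk_sup_mk, Prod.mk_inf_mk, sup_idem, inf_idem] at this
    exact this
  · have h3 := h1 (s, a) (s', b)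
    have h4 := h2 (show (s, a ⊓ b) ≤ (s, a) from ⟨le_rfl, inf_le_left⟩)
    simp only [Prod.mk_sup_mk, Prod.mk_inf_mk, sup_of_le_right hs, inf_of_le_left hs] at h3 h4
    change M.qOf z (M.optV z) s a + M.qOf z' (M.optV z') s' b
      ≤ M.qOf z (M.optV z) s (a ⊓ b) + M.qOf z' (M.optV z') s' (a ⊔ b)
    linarith

theorem expect_Phi (z : stdSimplex ℝ S) (μ : Strategy S A) (f : S → ℝ) :
    expect (M.Phi z μ) f = expect z fun s => ∑ a, (μ s).1 a * expect (M.P s a z) f := by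
  simp only [expect, Phi, Finset.sum_mul, Finset.mul_sum]
  rw [Finset.sum_comm]
  refine Finset.sum_congr rfl fun s _ => ?_
  rw [Finset.sum_comm]
  exact Finset.sum_congr rfl fun a _ => Finset.sum_congr rfl fun s' _ => by ring

/-- The trembling best response map `z ↦ Φ(z, π^ε_{Q^*_z})`. -/
def respond (M : Game S A) (z : stdSimplex ℝ S) : stdSimplex ℝ S :=
  M.Phi z (M.trembling (M.optQ z))

theorem IsSC.respond_sdle (hM : M.IsSC) {z z' : stdSimplex ℝ S} (hz : SDLe z z') :
    SDLe (M.respond z) (M.respond z') := by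
  intro f hf
  have key : ∀ {z z' : stdSimplex ℝ S}, SDLe z z' → ∀ {s s' : S}, s ≤ s' →
      ∑ a, (M.trembling (M.optQ z) s).1 a * expect (M.P s a z) f
        ≤ ∑ a, (M.trembling (M.optQ z') s').1 a * expect (M.P s' a z') f := by
    intro z z' hz s s' hs
    have h1 : ∀ {a a' : A}, a ≤ a' → expect (M.P s a z) f ≤ expect (M.P s' a' z') f := by
      intro a a' ha
      exact (hM.trans_mono z f hf (show (s, a) ≤ (s', a') from ⟨hs, ha⟩)).trans
        (hM.trans_mono_field s' a' z z' hz f hf)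
    rw [trembling, trembling, sum_tremble_mul, sum_tremble_mul]
    refine add_le_add (mul_le_mul_of_nonneg_left (Finset.sum_le_sum fun a _ => h1 le_rfl)
      M.tremor_nonneg) (mul_le_mul_of_nonneg_left (h1 (hM.greedy_optQ_le hz hs))
        (sub_nonneg.2 M.ε_lt.le))
  rw [respond, respond, expect_Phi, expect_Phi]
  -- `key` is used twice: at a fixed state, to raise the integrand from field `z` to `z'`; then at
  -- the fixed field `z'`, to see that the integrand is monotone in the state, so that the
  -- integrating measure can be raised.
  exact (expect_le_expect z fun s => key hz le_rfl).trans (hz _ fun s s' hs => key (SDLe.refl z') hs)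

theorem IsSC.exists_tendsto_tbr [OrderBot S] (hM : M.IsSC) :
    ∃ z, Tendsto M.tbr atTop (𝓝 z) := by
  refine exists_tendsto_of_sdle fun k => ?_
  induction k with
  | zero => exact pointMass_bot_sdle _
  | succ k ih => exact hM.respond_sdle ih

end Complementarities

/-! ### Lipschitz estimates and the equilibrium property of the limit -/

section Lipschitz

variable {C₁ C₂ C₃ : ℝ}

theorem constD_eq (M : Game S A) (C₁ C₂ : ℝ) :
    constD M.γ C₁ C₂ = (C₁ + M.γ * (M.vmax * C₂)) / (1 - M.γ) := by
  have : 1 - M.γ ≠ 0 := by linarith [M.γ_lt]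
  unfold constD vmax
  field_simp

theorem IsLipschitz.constD_nonneg (hL : M.IsLipschitz C₁ C₂ C₃) : 0 ≤ constD M.γ C₁ C₂ := by
  have h1 : 0 < 1 - M.γ := by linarith [M.γ_lt]
  have h2 := M.one_le_vmax
  have h3 := hL.nonneg₁
  have h4 := hL.nonneg₂
  have h5 := M.γ_nonneg
  rw [constD_eq]
  positivity

/-- As `optV` is `G` of `optQ` and `G` is nonexpansive, the distance `c` satisfies `c ≤ C₁ l + γ
(vmax C₂ l + c)`; solving for `c` gives the constant `D`. -/
theorem IsLipschitz.norm_optQ_sub_le (hL : M.IsLipschitz C₁ C₂ C₃) (z z' : stdSimplex ℝ S) :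
    ‖M.optQ z - M.optQ z'‖ ≤ constD M.γ C₁ C₂ * l1dist z z' := by
  set l := l1dist z z'
  have hl : 0 ≤ l := l1dist_nonneg z z'
  have h1 : 0 < 1 - M.γ := by linarith [M.γ_lt]
  have hv := zero_le_one.trans M.one_le_vmax
  set c := ‖M.optQ z - M.optQ z'‖ with hc
  have hQ : ∀ s a, |M.optQ z s a - M.optQ z' s a| ≤ c := fun s a =>
    (norm_le_pi_norm ((M.optQ z - M.optQ z') s) a).trans (norm_le_pi_norm _ s)
  have hV : ∀ s, |M.optV z s - M.optV z' s| ≤ c := by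
    intro s
    rw [← G_optQ, ← G_optQ]
    exact M.abs_G_sub_G_le fun a => hQ s a
  have h2 : c ≤ C₁ * l + M.γ * (M.vmax * (C₂ * l) + c) := by
    have h0 : 0 ≤ C₁ * l + M.γ * (M.vmax * (C₂ * l) + c) := by
      have h3 := hL.nonneg₁
      have h4 := hL.nonneg₂
      have h5 := M.γ_nonneg
      positivity
    refine (pi_norm_le_iff_of_nonneg h0).2 fun s => (pi_norm_le_iff_of_nonneg h0).2 fun a => ?_
    have h3 : (M.optQ z - M.optQ z') s a = (M.r s a z - M.r s a z')
        + M.γ * ((expect (M.P s a z) (M.optV z) - expect (M.P s a z') (M.optV z))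
          + (expect (M.P s a z') (M.optV z) - expect (M.P s a z') (M.optV z'))) := by
      simp only [Pi.sub_apply, optQ]
      ring
    rw [h3, Real.norm_eq_abs]
    refine (abs_add_le _ _).trans (add_le_add (hL.reward s a z z') ?_)
    rw [abs_mul, abs_of_nonneg M.γ_nonneg]
    refine mul_le_mul_of_nonneg_left ((abs_add_le _ _).trans (add_le_add ?_ ?_)) M.γ_nonneg
    · exact (abs_expect_sub_le_l1dist _ _ (M.abs_optV_le z)).trans
        (mul_le_mul_of_nonneg_left (hL.trans s a z z') hv)
    · exact abs_expect_sub_expect_le _ hV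
  rw [constD_eq, div_mul_eq_mul_div, le_div_iff₀ h1]
  linarith

theorem IsLipschitz.l1dist_Phi_le (hL : M.IsLipschitz C₁ C₂ C₃) (z z' : stdSimplex ℝ S)
    (μ : Strategy S A) : l1dist (M.Phi z μ) (M.Phi z' μ) ≤ (1 + C₂) * l1dist z z' := by
  have h1 : ∀ s', |(M.Phi z μ).1 s' - (M.Phi z' μ).1 s'|
      ≤ ∑ s, ∑ a, (|z.1 s - z'.1 s| * ((μ s).1 a * (M.P s a z).1 s')
        + z'.1 s * ((μ s).1 a * |(M.P s a z).1 s' - (M.P s a z').1 s'|)) := by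
    intro s'
    simp only [Phi]
    rw [← Finset.sum_sub_distrib]
    refine (Finset.abs_sum_le_sum_abs _ _).trans (Finset.sum_le_sum fun s _ => ?_)
    rw [← Finset.sum_sub_distrib]
    refine (Finset.abs_sum_le_sum_abs _ _).trans (Finset.sum_le_sum fun a _ => ?_)
    have h2 : z.1 s * (μ s).1 a * (M.P s a z).1 s' - z'.1 s * (μ s).1 a * (M.P s a z').1 s'
        = (z.1 s - z'.1 s) * ((μ s).1 a * (M.P s a z).1 s')
          + z'.1 s * ((μ s).1 a * ((M.P s a z).1 s' - (M.P s a z').1 s')) := by ring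
    rw [h2]
    refine (abs_add_le _ _).trans_eq ?_
    simp only [abs_mul, abs_of_nonneg ((μ s).2.1 a), abs_of_nonneg ((M.P s a z).2.1 s'),
      abs_of_nonneg (z'.2.1 s)]
  have h3 : ∀ s a, ∑ s', (|z.1 s - z'.1 s| * ((μ s).1 a * (M.P s a z).1 s')
        + z'.1 s * ((μ s).1 a * |(M.P s a z).1 s' - (M.P s a z').1 s'|))
      ≤ (μ s).1 a * (|z.1 s - z'.1 s| + z'.1 s * (C₂ * l1dist z z')) := by
    intro s a
    rw [Finset.sum_add_distrib]
    simp only [← Finset.mul_sum, (M.P s a z).2.2]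
    have := mul_le_mul_of_nonneg_left (hL.trans s a z z')
      (mul_nonneg (z'.2.1 s) ((μ s).2.1 a))
    rw [l1dist] at this
    linarith
  calc l1dist (M.Phi z μ) (M.Phi z' μ)
      ≤ ∑ s', ∑ s, ∑ a, (|z.1 s - z'.1 s| * ((μ s).1 a * (M.P s a z).1 s')
        + z'.1 s * ((μ s).1 a * |(M.P s a z).1 s' - (M.P s a z').1 s'|)) :=
        Finset.sum_le_sum fun s' _ => h1 s'
    _ = ∑ s, ∑ a, ∑ s', (|z.1 s - z'.1 s| * ((μ s).1 a * (M.P s a z).1 s')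
        + z'.1 s * ((μ s).1 a * |(M.P s a z).1 s' - (M.P s a z').1 s'|)) := by
        rw [Finset.sum_comm]
        exact Finset.sum_congr rfl fun s _ => Finset.sum_comm
    _ ≤ ∑ s, ∑ a, (μ s).1 a * (|z.1 s - z'.1 s| + z'.1 s * (C₂ * l1dist z z')) :=
        Finset.sum_le_sum fun s _ => Finset.sum_le_sum fun a _ => h3 s a
    _ = (1 + C₂) * l1dist z z' := by
        simp only [← Finset.sum_mul, (μ _).2.2, one_mul, Finset.sum_add_distrib, z'.2.2]
        rw [add_mul, one_mul]
        rfl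

theorem l1dist_Phi_le_of_kern (z : stdSimplex ℝ S) (μ μ' : Strategy S A) {c : ℝ}
    (h : ∀ s, ∑ s', |M.kern z μ s s' - M.kern z μ' s s'| ≤ c) :
    l1dist (M.Phi z μ) (M.Phi z μ') ≤ c := by
  have h1 : ∀ (μ : Strategy S A) s', (M.Phi z μ).1 s' = ∑ s, z.1 s * M.kern z μ s s' := by
    intro μ s'
    simp only [Phi, kern, Matrix.of_apply, Finset.mul_sum, mul_assoc]
  calc l1dist (M.Phi z μ) (M.Phi z μ')
      ≤ ∑ s', ∑ s, z.1 s * |M.kern z μ s s' - M.kern z μ' s s'| := by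
        refine Finset.sum_le_sum fun s' _ => ?_
        rw [h1, h1, ← Finset.sum_sub_distrib]
        refine (Finset.abs_sum_le_sum_abs _ _).trans_eq (Finset.sum_congr rfl fun s _ => ?_)
        rw [← mul_sub, abs_mul, abs_of_nonneg (z.2.1 s)]
    _ = expect z fun s => ∑ s', |M.kern z μ s s' - M.kern z μ' s s'| := by
        rw [Finset.sum_comm]
        simp only [expect, Finset.mul_sum]
    _ ≤ c := (expect_le_expect z h).trans_eq (expect_const z c)

/-- One step of approximate trembling best response, compared with the exact one from `z'`. -/
theorem IsLipschitz.l1dist_Phi_respond_le (hL : M.IsLipschitz C₁ C₂ C₃) (z z' : stdSimplex ℝ S)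
    (Q : S → A → ℝ) :
    l1dist (M.Phi z (M.trembling Q)) (M.respond z')
      ≤ (1 + C₂ + C₃ * constD M.γ C₁ C₂) * l1dist z z' + C₃ * ‖M.optQ z - Q‖ := by
  have h1 : l1dist (M.Phi z (M.trembling Q)) (M.Phi z (M.trembling (M.optQ z')))
      ≤ C₃ * ‖M.optQ z' - Q‖ := by
    rw [l1dist_comm]
    exact l1dist_Phi_le_of_kern z _ _ fun s => hL.strategy z z' Q s
  have h2 : ‖M.optQ z' - Q‖ ≤ constD M.γ C₁ C₂ * l1dist z z' + ‖M.optQ z - Q‖ := by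
    calc ‖M.optQ z' - Q‖ = ‖(M.optQ z' - M.optQ z) + (M.optQ z - Q)‖ := by congr 1; abel
      _ ≤ _ := norm_add_le _ _
      _ ≤ _ := by
        rw [l1dist_comm]
        exact add_le_add (hL.norm_optQ_sub_le z' z) le_rfl
  have h3 := hL.l1dist_Phi_le z z' (M.trembling (M.optQ z'))
  have h4 := l1dist_triangle (M.Phi z (M.trembling Q)) (M.Phi z (M.trembling (M.optQ z')))
    (M.respond z')
  have h5 := mul_le_mul_of_nonneg_left h2 hL.nonneg₃
  simp only [respond] at h4 ⊢
  linarith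

theorem IsLipschitz.l1dist_respond_le (hL : M.IsLipschitz C₁ C₂ C₃) (z z' : stdSimplex ℝ S) :
    l1dist (M.respond z) (M.respond z')
      ≤ (1 + C₂ + C₃ * constD M.γ C₁ C₂) * l1dist z z' := by
  have := hL.l1dist_Phi_respond_le z z' (M.optQ z)
  simpa [respond] using this

/-- A limit of the trembling best response dynamics is an equilibrium. -/
theorem IsLipschitz.isTMFE_of_tendsto [OrderBot S] (hL : M.IsLipschitz C₁ C₂ C₃)
    {z : stdSimplex ℝ S} (hz : Tendsto M.tbr atTop (𝓝 z)) :
    M.IsTMFE z (M.trembling (M.optQ z)) := by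
  refine ⟨⟨_, rfl⟩, fun s => congrFun (M.value_trembling_optQ z) s, ?_⟩
  have h1 : Tendsto (fun k => l1dist (M.tbr k) z) atTop (𝓝 0) := by
    have := ((continuous_l1dist_left z).tendsto z).comp hz
    rwa [l1dist_self] at this
  have h2 : Tendsto (fun k => (1 + C₂ + C₃ * constD M.γ C₁ C₂) * l1dist (M.tbr k) z
      + l1dist (M.tbr (k + 1)) z) atTop (𝓝 0) := by
    have := (h1.const_mul (1 + C₂ + C₃ * constD M.γ C₁ C₂)).add (h1.comp (tendsto_add_atTop_nat 1))
    simpa using this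
  -- The distance from `respond z` to `z` is estimated through `tbr (k + 1) = respond (tbr k)`,
  -- which is close to both for large `k`.
  refine eq_of_l1dist_le_zero (ge_of_tendsto' h2 fun k => ?_)
  have h3 := l1dist_triangle (M.respond z) (M.respond (M.tbr k)) z
  have h4 := hL.l1dist_respond_le (M.tbr k) z
  rw [l1dist_comm] at h4
  exact h3.trans (add_le_add h4 le_rfl)

end Lipschitz

end Game

/-! ### Polynomial learning rates and the weights they induce -/

section LearningRate

/-- The polynomial learning rate of the visit number `i` (counted from zero). -/
def lr (w : ℝ) (i : ℕ) : ℝ := 1 / ((i : ℝ) + 1) ^ w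

variable {w : ℝ}

theorem lr_nonneg (w : ℝ) (i : ℕ) : 0 ≤ lr w i := by unfold lr; positivity

theorem lr_le_one (hw : 0 ≤ w) (i : ℕ) : lr w i ≤ 1 := by
  unfold lr
  rw [div_le_one (by positivity)]
  exact Real.one_le_rpow (by linarith [(Nat.cast_nonneg i : (0 : ℝ) ≤ i)]) hw

theorem lr_zero (w : ℝ) : lr w 0 = 1 := by simp [lr]

/-- The weight of the sample at visit `i` in the average after `n` visits. -/
def eta (w : ℝ) (n i : ℕ) : ℝ := lr w i * ∏ j ∈ Finset.Ico (i + 1) n, (1 - lr w j)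

theorem eta_succ {n i : ℕ} (h : i < n) : eta w (n + 1) i = (1 - lr w n) * eta w n i := by
  rw [eta, Finset.prod_Ico_succ_top (by omega), eta]
  ring

theorem eta_succ_self (n : ℕ) : eta w (n + 1) n = lr w n := by simp [eta]

theorem eta_nonneg (hw : 0 ≤ w) (n i : ℕ) : 0 ≤ eta w n i :=
  mul_nonneg (lr_nonneg w i) (Finset.prod_nonneg fun j _ => sub_nonneg.2 (lr_le_one hw j))

/-- Equivalent to `(n + 2) ^ w ≤ (n + 1) ^ w + 1`, the subadditivity of `x ^ w`. It says that a
discounted old sample never weighs more than the newest one, which is why all weights are at most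
the latest rate. -/
theorem lr_mul_one_sub_le (hw : 0 ≤ w) (hw' : w ≤ 1) (n : ℕ) :
    lr w n * (1 - lr w (n + 1)) ≤ lr w (n + 1) := by
  have h0 : (0 : ℝ) < (n : ℝ) + 1 := by positivity
  have h1 : ((n : ℝ) + 1 + 1) ^ w ≤ ((n : ℝ) + 1) ^ w + 1 := by
    have := Real.rpow_add_le_add_rpow (a := (n : ℝ) + 1) (b := 1) h0.le zero_le_one hw hw'
    simpa using this
  have h2 : 0 < ((n : ℝ) + 1) ^ w := by positivity
  have h3 : 0 < ((n : ℝ) + 1 + 1) ^ w := by positivity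
  unfold lr
  push_cast
  have h4 : 1 / ((n : ℝ) + 1) ^ w * (1 - 1 / ((n : ℝ) + 1 + 1) ^ w)
      = (((n : ℝ) + 1 + 1) ^ w - 1) / (((n : ℝ) + 1) ^ w * ((n : ℝ) + 1 + 1) ^ w) := by
    field_simp
  rw [h4, div_le_div_iff₀ (by positivity) h3]
  nlinarith

theorem eta_le (hw : 0 ≤ w) (hw' : w ≤ 1) {n i : ℕ} (h : i < n) :
    eta w n i ≤ 1 / (n : ℝ) ^ w := by
  induction n with
  | zero => omega
  | succ n ih =>
    rcases Nat.lt_succ_iff_lt_or_eq.1 h with h | rfl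
    · rw [eta_succ h]
      obtain ⟨m, rfl⟩ : ∃ m, n = m + 1 := ⟨n - 1, by omega⟩
      have h1 : eta w (m + 1) i ≤ lr w m := by
        have := ih h
        push_cast at this
        exact this
      have h2 := mul_le_mul_of_nonneg_right h1 (sub_nonneg.2 (lr_le_one hw (m + 1)))
      have h3 := lr_mul_one_sub_le hw hw' m
      have h4 : lr w (m + 1) = 1 / ((m + 1 + 1 : ℕ) : ℝ) ^ w := by
        unfold lr; push_cast; rfl
      linarith
    · rw [eta_succ_self, lr]
      push_cast
      exact le_rfl

theorem sum_eta_le_one (hw : 0 ≤ w) (n : ℕ) : ∑ i ∈ Finset.range n, eta w n i ≤ 1 := by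
  induction n with
  | zero => simp
  | succ n ih =>
    rw [Finset.sum_range_succ, eta_succ_self,
      Finset.sum_congr rfl fun i hi => eta_succ (Finset.mem_range.1 hi), ← Finset.mul_sum]
    have := mul_le_mul_of_nonneg_left ih (sub_nonneg.2 (lr_le_one hw n))
    linarith

/-- The weights sum to at most one and each is at most `n ^ (-w)`. This is the variance proxy in the
concentration bound. -/
theorem sum_eta_sq_le (hw : 0 ≤ w) (hw' : w ≤ 1) (n : ℕ) :
    ∑ i ∈ Finset.range n, eta w n i ^ 2 ≤ 1 / (n : ℝ) ^ w := by
  calc ∑ i ∈ Finset.range n, eta w n i ^ 2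
      ≤ ∑ i ∈ Finset.range n, 1 / (n : ℝ) ^ w * eta w n i := by
        refine Finset.sum_le_sum fun i hi => ?_
        rw [sq]
        exact mul_le_mul_of_nonneg_right (eta_le hw hw' (Finset.mem_range.1 hi))
          (eta_nonneg hw n i)
    _ ≤ 1 / (n : ℝ) ^ w := by
        rw [← Finset.mul_sum]
        exact mul_le_of_le_one_right (by positivity) (sum_eta_le_one hw n)

end LearningRate

namespace Game

/-! ### Visit counts, averaged noise and covering -/

section Visits

variable {S A : Type*} [DecidableEq S] [DecidableEq A] (pair : ℕ → S × A) {w : ℝ}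

theorem visits_succ (t : ℕ) (x : S × A) :
    visits pair (t + 1) x = visits pair t x + if pair t = x then 1 else 0 := by
  unfold visits
  rw [Finset.range_add_one, Finset.filter_insert]
  split_ifs with h
  · rw [Finset.card_insert_of_notMem (by simp)]
  · rfl

theorem visits_mono (x : S × A) : Monotone fun t => visits pair t x :=
  monotone_nat_of_le_succ fun t => by rw [visits_succ]; exact Nat.le_add_right _ _

theorem visits_le (t : ℕ) (x : S × A) : visits pair t x ≤ t := by
  unfold visits
  exact (Finset.card_filter_le _ _).trans (Finset.card_range t).le

theorem sum_visits (g : ℕ → ℝ) (x : S × A) (T : ℕ) :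
    ∑ j ∈ Finset.range T, (if pair j = x then g (visits pair j x) else 0)
      = ∑ i ∈ Finset.range (visits pair T x), g i := by
  induction T with
  | zero => simp [visits]
  | succ T ih =>
    rw [Finset.sum_range_succ, ih, visits_succ]
    split_ifs with h
    · rw [Finset.sum_range_succ]
    · simp

/-- The weight at time `j` in the average of the noise at `x` after `n` visits of `x`. -/
def weight (w : ℝ) (n : ℕ) (x : S × A) (j : ℕ) : ℝ :=
  if pair j = x then (if visits pair j x < n then eta w n (visits pair j x) else 0) else 0

theorem sum_weight_sq_le (hw : 0 ≤ w) (hw' : w ≤ 1) (n : ℕ) (x : S × A) (T : ℕ) :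
    ∑ j ∈ Finset.range T, weight pair w n x j ^ 2 ≤ 1 / (n : ℝ) ^ w := by
  have h1 : ∀ j, weight pair w n x j ^ 2
      = if pair j = x then (if visits pair j x < n then eta w n (visits pair j x) ^ 2 else 0)
        else 0 := by
    intro j
    unfold weight
    split_ifs <;> simp
  simp only [h1]
  rw [sum_visits pair (fun i => if i < n then eta w n i ^ 2 else 0) x T, ← Finset.sum_filter]
  refine (Finset.sum_le_sum_of_subset_of_nonneg (t := Finset.range n) ?_ ?_).trans
    (sum_eta_sq_le hw hw' n)
  · intro i
    simp
  · intro i _ _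
    positivity

/-- The running averages, with the learning rates, of the noise `ξ`. -/
def noiseAvg (w : ℝ) (ξ : ℕ → ℝ) : ℕ → S × A → ℝ
  | 0 => fun _ => 0
  | t + 1 => fun x =>
      if x = pair t then
        (1 - lr w (visits pair t x)) * noiseAvg w ξ t x + lr w (visits pair t x) * ξ t
      else noiseAvg w ξ t x

theorem noiseAvg_eq_sum_weight (ξ : ℕ → ℝ) (t : ℕ) (x : S × A) :
    noiseAvg pair w ξ t x
      = ∑ j ∈ Finset.range t, weight pair w (visits pair t x) x j * ξ j := by
  induction t with
  | zero => simp [noiseAvg]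
  | succ t ih =>
    rw [Finset.sum_range_succ, noiseAvg]
    dsimp only
    by_cases hx : x = pair t
    · have hv : visits pair (t + 1) x = visits pair t x + 1 := by
        rw [visits_succ, if_pos hx.symm]
      rw [if_pos hx, ih, hv, Finset.mul_sum]
      congr 1
      · refine Finset.sum_congr rfl fun j hj => ?_
        unfold weight
        by_cases hj' : pair j = x
        · have h1 : visits pair j x < visits pair t x := by
            have h2 : visits pair (j + 1) x ≤ visits pair t x :=
              visits_mono pair x (Finset.mem_range.1 hj)
            rw [visits_succ, if_pos hj'] at h2
            omega
          rw [if_pos hj', if_pos hj', if_pos h1, if_pos (by omega), eta_succ h1]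
          ring
        · simp [hj']
      · simp [weight, hx.symm, eta_succ_self]
    · have hv : visits pair (t + 1) x = visits pair t x := by
        rw [visits_succ, if_neg (Ne.symm hx), add_zero]
      rw [if_neg hx, ih, hv]
      simp [weight, Ne.symm hx]

/-- Visits after time `t` have weight zero, so the average at any time is a sum over the full
horizon that depends on `t` only through the visit number. A union bound over visit numbers thus
controls all times. -/
theorem noiseAvg_eq_sum_weight_of_le (ξ : ℕ → ℝ) {t T : ℕ} (h : t ≤ T) (x : S × A) :
    noiseAvg pair w ξ t x
      = ∑ j ∈ Finset.range T, weight pair w (visits pair t x) x j * ξ j := by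
  rw [noiseAvg_eq_sum_weight]
  refine Finset.sum_subset (Finset.range_mono h) fun j _ hj => ?_
  have h1 : visits pair t x ≤ visits pair j x := visits_mono pair x (by simpa using hj)
  simp [weight, h1.not_gt]

/-- Up to time `T`, every pair is visited in every `L` consecutive steps. -/
def Covers (T L : ℕ) : Prop :=
  ∀ t, t + L ≤ T → ∀ x : S × A, ∃ j, t ≤ j ∧ j < t + L ∧ pair j = x

variable {pair}

theorem Covers.visits_add_le {T L : ℕ} (h : Covers pair T L) (m t : ℕ) (ht : t + L * m ≤ T)
    (x : S × A) : visits pair t x + m ≤ visits pair (t + L * m) x := by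
  induction m with
  | zero => simp
  | succ m ih =>
    have h1 : L * (m + 1) = L * m + L := by ring
    rw [h1] at ht ⊢
    obtain ⟨j, hj1, hj2, hj3⟩ := h (t + L * m) (by omega) x
    have h2 : visits pair (t + L * m) x ≤ visits pair j x := visits_mono pair x hj1
    have h3 : visits pair (j + 1) x ≤ visits pair (t + (L * m + L)) x :=
      visits_mono pair x (by omega)
    rw [visits_succ, if_pos hj3] at h3
    have := ih (by omega)
    omega

end Visits

/-! ### Pathwise analysis of asynchronous Q-learning -/

section QLearning

variable {S A : Type*} [Fintype S] [DecidableEq S] [Lattice S]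
  [Fintype A] [DecidableEq A] [Lattice A] [Nontrivial A] (M : Game S A)
  {w : ℝ} (z : stdSimplex ℝ S) (pair : ℕ → S × A) (next : ℕ → S)

theorem qIter_succ (t : ℕ) (s : S) (a : A) :
    M.qIter w z pair next (t + 1) s a =
      if (s, a) = pair t then
        (1 - lr w (visits pair t (s, a))) * M.qIter w z pair next t s a +
          lr w (visits pair t (s, a)) *
            (M.r s a z + M.γ * M.G (M.qIter w z pair next t) (next t))
      else M.qIter w z pair next t s a := rfl

theorem abs_qIter_le (hw : 0 ≤ w) (t : ℕ) (s : S) (a : A) :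
    |M.qIter w z pair next t s a| ≤ M.vmax := by
  induction t generalizing s a with
  | zero => simpa [qIter] using zero_le_one.trans M.one_le_vmax
  | succ t ih =>
    rw [qIter_succ]
    split_ifs
    · have h1 : |M.r s a z + M.γ * M.G (M.qIter w z pair next t) (next t)| ≤ M.vmax := by
        rw [← one_add_γ_mul_vmax]
        refine (abs_add_le _ _).trans (add_le_add (M.abs_r_le s a z) ?_)
        rw [abs_mul, abs_of_nonneg M.γ_nonneg]
        exact mul_le_mul_of_nonneg_left (M.abs_G_le fun a => ih _ a) M.γ_nonneg
      set l := lr w (visits pair t (s, a))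
      have hl0 : 0 ≤ l := lr_nonneg _ _
      have hl1 : 0 ≤ 1 - l := sub_nonneg.2 (lr_le_one hw _)
      refine (abs_add_le _ _).trans ?_
      rw [abs_mul, abs_mul, abs_of_nonneg hl0, abs_of_nonneg hl1]
      nlinarith [mul_le_mul_of_nonneg_left h1 hl0, mul_le_mul_of_nonneg_left (ih s a) hl1]
    · exact ih s a

/-- The rate of the first visit is 1, which erases the initial value; from then on the entry is an
average of samples `r + γ G`. -/
theorem abs_qIter_sub_r_le (hw : 0 ≤ w) (t : ℕ) (s : S) (a : A) (h : 0 < visits pair t (s, a)) :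
    |M.qIter w z pair next t s a - M.r s a z| ≤ M.γ * M.vmax := by
  induction t with
  | zero => simp [visits] at h
  | succ t ih =>
    rw [qIter_succ]
    split_ifs with hx
    · set l := lr w (visits pair t (s, a)) with hl
      have hG : |M.γ * M.G (M.qIter w z pair next t) (next t)| ≤ M.γ * M.vmax := by
        rw [abs_mul, abs_of_nonneg M.γ_nonneg]
        exact mul_le_mul_of_nonneg_left (M.abs_G_le fun a => M.abs_qIter_le z pair next hw t _ a)
          M.γ_nonneg
      have hl0 : 0 ≤ l := lr_nonneg _ _
      have hl1 : 0 ≤ 1 - l := sub_nonneg.2 (lr_le_one hw _)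
      have h1 : (1 - l) * |M.qIter w z pair next t s a - M.r s a z| ≤ (1 - l) * (M.γ * M.vmax) := by
        rcases Nat.eq_zero_or_pos (visits pair t (s, a)) with h0 | h0
        · rw [hl, h0, lr_zero]
          simp
        · exact mul_le_mul_of_nonneg_left (ih h0) hl1
      have h2 : (1 - l) * M.qIter w z pair next t s a
          + l * (M.r s a z + M.γ * M.G (M.qIter w z pair next t) (next t)) - M.r s a z
          = (1 - l) * (M.qIter w z pair next t s a - M.r s a z)
            + l * (M.γ * M.G (M.qIter w z pair next t) (next t)) := by ring
      rw [h2]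
      refine (abs_add_le _ _).trans ?_
      rw [abs_mul, abs_mul, abs_of_nonneg hl0, abs_of_nonneg hl1]
      linarith [mul_le_mul_of_nonneg_left hG hl0]
    · rw [visits_succ, if_neg (Ne.symm hx), add_zero] at h
      exact ih h

theorem abs_optQ_sub_qIter_le_of_visited (hw : 0 ≤ w) (t : ℕ) (s : S) (a : A)
    (h : 0 < visits pair t (s, a)) :
    |M.optQ z s a - M.qIter w z pair next t s a| ≤ 2 * (M.γ * M.vmax) := by
  have h1 := M.abs_qIter_sub_r_le z pair next hw t s a h
  have h2 : |M.optQ z s a - M.r s a z| ≤ M.γ * M.vmax := by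
    rw [optQ, add_sub_cancel_left, abs_mul, abs_of_nonneg M.γ_nonneg]
    exact mul_le_mul_of_nonneg_left (abs_expect_le _ (M.abs_optV_le z)) M.γ_nonneg
  rw [abs_le] at *
  constructor <;> linarith [h1.1, h1.2, h2.1, h2.2]

/-- The deviation of the sampled continuation value at time `j` from its conditional mean. -/
def noise (w : ℝ) (j : ℕ) : ℝ :=
  M.γ * (M.G (M.qIter w z pair next j) (next j)
    - expect (M.P (pair j).1 (pair j).2 z) (M.G (M.qIter w z pair next j)))

/-- The error of Q-learning without the averaged noise. -/
def drift (w : ℝ) (t : ℕ) (s : S) (a : A) : ℝ :=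
  M.qIter w z pair next t s a - M.optQ z s a
    - noiseAvg pair w (M.noise z pair next w) t (s, a)

/-- Subtracting the averaged noise leaves an average towards an exact Bellman increment, which is at
most `γ` times the current error. -/
theorem drift_succ (t : ℕ) (s : S) (a : A) :
    M.drift z pair next w (t + 1) s a =
      if (s, a) = pair t then
        (1 - lr w (visits pair t (s, a))) * M.drift z pair next w t s a +
          lr w (visits pair t (s, a)) * (M.γ *
            (expect (M.P s a z) (M.G (M.qIter w z pair next t)) - expect (M.P s a z) (M.optV z)))
      else M.drift z pair next w t s a := by
  unfold drift
  rw [qIter_succ, noiseAvg]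
  dsimp only
  split_ifs with hx
  · rw [noise, ← hx, optQ]
    ring
  · rfl

variable {M z pair next}

/-- The excess of the drift over `γ D` starts at most at `(1 - γ) D + u`, and each visit multiplies
its bound by `1 - l ≤ exp (-l)`. Up to the horizon every rate `l` is at least `T ^ (-w)`. -/
theorem abs_drift_sub_le (hw : 0 ≤ w) {τ T : ℕ} {D u : ℝ}
    (hD : ∀ t, τ ≤ t → t ≤ T → ∀ s a, |M.qIter w z pair next t s a - M.optQ z s a| ≤ D)
    (hu : ∀ x, |noiseAvg pair w (M.noise z pair next w) τ x| ≤ u)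
    (s : S) (a : A) (t : ℕ) (ht : τ ≤ t) (htT : t ≤ T) :
    |M.drift z pair next w t s a| - M.γ * D
      ≤ Real.exp (-(((visits pair t (s, a) : ℝ) - visits pair τ (s, a)) / (T : ℝ) ^ w))
        * ((1 - M.γ) * D + u) := by
  have hD0 : 0 ≤ D := (abs_nonneg _).trans (hD t ht htT s a)
  have hu0 : 0 ≤ u := (abs_nonneg _).trans (hu (s, a))
  have hγ : 0 ≤ 1 - M.γ := by linarith [M.γ_lt]
  have hR : 0 ≤ (1 - M.γ) * D + u := by positivity
  induction t, ht using Nat.le_induction with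
  | base =>
    simp only [sub_self, zero_div, neg_zero, Real.exp_zero, one_mul]
    have h1 := (abs_sub _ _ : |M.qIter w z pair next τ s a - M.optQ z s a
      - noiseAvg pair w (M.noise z pair next w) τ (s, a)| ≤ _)
    have h2 := hD τ le_rfl htT s a
    have h3 := hu (s, a)
    rw [drift]
    linarith
  | succ t ht ih =>
    have ih' := ih (by omega)
    rw [drift_succ, visits_succ]
    split_ifs with hx hx' hx'
    · set l := lr w (visits pair t (s, a)) with hl
      set R := (1 - M.γ) * D + u
      have hl0 : 0 ≤ l := lr_nonneg _ _
      have hl1 : 0 ≤ 1 - l := sub_nonneg.2 (lr_le_one hw _)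
      have h1 : |M.γ * (expect (M.P s a z) (M.G (M.qIter w z pair next t))
          - expect (M.P s a z) (M.optV z))| ≤ M.γ * D := by
        rw [abs_mul, abs_of_nonneg M.γ_nonneg, ← G_optQ]
        refine mul_le_mul_of_nonneg_left (abs_expect_sub_expect_le _ fun s' => ?_) M.γ_nonneg
        exact M.abs_G_sub_G_le fun a => hD t ht (by omega) s' a
      have h2 : |(1 - l) * M.drift z pair next w t s a + l * (M.γ *
          (expect (M.P s a z) (M.G (M.qIter w z pair next t)) - expect (M.P s a z) (M.optV z)))|
          - M.γ * D ≤ (1 - l) * (|M.drift z pair next w t s a| - M.γ * D) := by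
        have := abs_add_le ((1 - l) * M.drift z pair next w t s a) (l * (M.γ *
          (expect (M.P s a z) (M.G (M.qIter w z pair next t)) - expect (M.P s a z) (M.optV z))))
        rw [abs_mul, abs_mul (l), abs_of_nonneg hl0, abs_of_nonneg hl1] at this
        linarith [mul_le_mul_of_nonneg_left h1 hl0]
      refine h2.trans ((mul_le_mul_of_nonneg_left ih' hl1).trans ?_)
      rw [← mul_assoc]
      refine mul_le_mul_of_nonneg_right ?_ hR
      have hlT : 1 / (T : ℝ) ^ w ≤ l := by
        rw [hl, lr]
        have h5 : (visits pair t (s, a) : ℝ) + 1 ≤ T := by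
          have := visits_le pair t (s, a)
          exact_mod_cast (show visits pair t (s, a) + 1 ≤ T by omega)
        exact one_div_le_one_div_of_le (by positivity)
          (Real.rpow_le_rpow (by positivity) h5 hw)
      have h6 : 1 - l ≤ Real.exp (-(1 / (T : ℝ) ^ w)) := by
        refine le_trans ?_ (Real.exp_le_exp.2 (neg_le_neg hlT))
        have := Real.add_one_le_exp (-l)
        linarith
      refine (mul_le_mul_of_nonneg_right h6 (Real.exp_pos _).le).trans_eq ?_
      rw [← Real.exp_add]
      congr 1
      push_cast
      ring
    · exact absurd hx.symm hx'
    · exact absurd hx'.symm hx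
    · rw [add_zero]
      exact ih'

/-- In `L * m` steps every pair gets `m ≥ T ^ w` visits, so the excess shrinks by `exp (-1) ≤ 1 /
2`. The new error is at most `γ D + ((1 - γ) D + u) / 2 + u`. -/
theorem abs_qIter_sub_optQ_le_of_phase (hw : 0 ≤ w) {τ T L m : ℕ} {D u : ℝ}
    (hT0 : 0 < T) (hcov : Covers pair T L) (hm : (T : ℝ) ^ w ≤ m) (hT : τ + L * m ≤ T)
    (hD : ∀ t, τ ≤ t → t ≤ T → ∀ s a, |M.qIter w z pair next t s a - M.optQ z s a| ≤ D)
    (hu : ∀ t, τ ≤ t → t ≤ T → ∀ x, |noiseAvg pair w (M.noise z pair next w) t x| ≤ u)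
    (t : ℕ) (ht : τ + L * m ≤ t) (htT : t ≤ T) (s : S) (a : A) :
    |M.qIter w z pair next t s a - M.optQ z s a| ≤ (1 - (1 - M.γ) / 2) * D + 2 * u := by
  have hτt : τ ≤ t := (Nat.le_add_right _ _).trans ht
  have hD0 : 0 ≤ D := (abs_nonneg _).trans (hD t hτt htT s a)
  have hu0 : 0 ≤ u := (abs_nonneg _).trans (hu t hτt htT (s, a))
  have hγ : 0 ≤ 1 - M.γ := by linarith [M.γ_lt]
  have h1 := abs_drift_sub_le hw hD (hu τ le_rfl (hτt.trans htT)) s a t hτt htT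
  have h2 : (m : ℝ) ≤ (visits pair t (s, a) : ℝ) - visits pair τ (s, a) := by
    have h3 := hcov.visits_add_le m τ hT (s, a)
    have h4 : visits pair (τ + L * m) (s, a) ≤ visits pair t (s, a) := visits_mono pair _ ht
    rw [le_sub_iff_add_le']
    exact_mod_cast h3.trans h4
  have hexp : Real.exp (-(((visits pair t (s, a) : ℝ) - visits pair τ (s, a)) / (T : ℝ) ^ w))
      ≤ 1 / 2 := by
    have h5 : (0 : ℝ) < (T : ℝ) ^ w := by positivity
    have h6 : 1 ≤ ((visits pair t (s, a) : ℝ) - visits pair τ (s, a)) / (T : ℝ) ^ w := by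
      rw [le_div_iff₀ h5]
      linarith
    refine (Real.exp_le_exp.2 (neg_le_neg h6)).trans ?_
    have h7 := Real.add_one_le_exp (1 : ℝ)
    rw [Real.exp_neg, ← one_div]
    exact one_div_le_one_div_of_le (by norm_num) (by linarith)
  have h8 : |M.qIter w z pair next t s a - M.optQ z s a|
      ≤ |M.drift z pair next w t s a| + u := by
    have h9 : M.qIter w z pair next t s a - M.optQ z s a = M.drift z pair next w t s a
        + noiseAvg pair w (M.noise z pair next w) t (s, a) := by rw [drift]; ring
    rw [h9]
    exact (abs_add_le _ _).trans (add_le_add le_rfl (hu t hτt htT (s, a)))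
  have hR : 0 ≤ (1 - M.γ) * D + u := by positivity
  have := mul_le_mul_of_nonneg_right hexp hR
  linarith

/-- With `β = (1 - γ) / 2`, the recursion `D ↦ (1 - β) D + 2 u` has the fixed point `2 u / β`, and
the initial error is at most `2 vmax`. -/
theorem abs_qIter_sub_optQ_le_of_phases (hw : 0 ≤ w) {τ T L m : ℕ} {u : ℝ}
    (hT0 : 0 < T) (hcov : Covers pair T L) (hm : (T : ℝ) ^ w ≤ m)
    (hu : ∀ t, τ ≤ t → t ≤ T → ∀ x, |noiseAvg pair w (M.noise z pair next w) t x| ≤ u)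
    (k t : ℕ) (ht : τ + k * (L * m) ≤ t) (htT : t ≤ T) (s : S) (a : A) :
    |M.qIter w z pair next t s a - M.optQ z s a|
      ≤ (1 - (1 - M.γ) / 2) ^ k * (2 * M.vmax) + 2 * u / ((1 - M.γ) / 2) := by
  have hγ : 0 < 1 - M.γ := by linarith [M.γ_lt]
  induction k generalizing t s a with
  | zero =>
    have hu0 : 0 ≤ u := (abs_nonneg _).trans (hu t (by omega) htT (s, a))
    have h1 := abs_sub (M.qIter w z pair next t s a) (M.optQ z s a)
    have h2 := M.abs_qIter_le z pair next hw t s a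
    have h3 := M.abs_optQ_le z s a
    have h4 : 0 ≤ 2 * u / ((1 - M.γ) / 2) := by positivity
    rw [pow_zero]
    linarith
  | succ k ih =>
    have h1 : τ + (k + 1) * (L * m) = τ + k * (L * m) + L * m := by ring
    rw [h1] at ht
    have h2 := abs_qIter_sub_optQ_le_of_phase (τ := τ + k * (L * m)) hw hT0 hcov hm (by omega)
      (fun t ht htT s a => ih t ht htT s a) (fun t ht htT x => hu t (by omega) htT x) t ht htT s a
    refine h2.trans_eq ?_
    rw [pow_succ]
    field_simp
    ring

/-- The pathwise error bound: if the averaged noise is small from time `τ` on and the horizon `T`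
leaves room for `k` phases, then the final Q-function is accurate. -/
theorem norm_optQ_sub_qIter_le (hw : 0 ≤ w) {τ T L m k : ℕ} {e : ℝ} (he : 0 ≤ e)
    (hT0 : 0 < T) (hcov : Covers pair T L) (hm : (T : ℝ) ^ w ≤ m) (hT : τ + k * (L * m) ≤ T)
    (hk : (1 - (1 - M.γ) / 2) ^ k * (2 * M.vmax) ≤ e / 2)
    (hu : ∀ t, τ ≤ t → t ≤ T → ∀ x,
      |noiseAvg pair w (M.noise z pair next w) t x| ≤ (1 - M.γ) / 2 * e / 4) :
    ‖M.optQ z - M.qIter w z pair next T‖ ≤ e := by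
  have hγ : 0 < 1 - M.γ := by linarith [M.γ_lt]
  refine (pi_norm_le_iff_of_nonneg he).2 fun s => (pi_norm_le_iff_of_nonneg he).2 fun a => ?_
  rw [Pi.sub_apply, Pi.sub_apply, Real.norm_eq_abs, abs_sub_comm]
  refine (abs_qIter_sub_optQ_le_of_phases hw hT0 hcov hm hu k T hT le_rfl s a).trans ?_
  have : 2 * ((1 - M.γ) / 2 * e / 4) / ((1 - M.γ) / 2) = e / 2 := by
    field_simp
    ring
  linarith

theorem norm_optQ_sub_qIter_le_of_covers (hw : 0 ≤ w) {T L : ℕ} {e : ℝ}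
    (hcov : Covers pair T L) (hT : L ≤ T) (he : 2 * (M.γ * M.vmax) ≤ e) :
    ‖M.optQ z - M.qIter w z pair next T‖ ≤ e := by
  have h0 : 0 ≤ e := by
    have := mul_nonneg M.γ_nonneg (zero_le_one.trans M.one_le_vmax)
    linarith
  refine (pi_norm_le_iff_of_nonneg h0).2 fun s => (pi_norm_le_iff_of_nonneg h0).2 fun a => ?_
  refine (M.abs_optQ_sub_qIter_le_of_visited z pair next hw T s a ?_).trans he
  have h1 := hcov.visits_add_le 1 0 (by omega) (s, a)
  have h2 : visits pair (0 + L * 1) (s, a) ≤ visits pair T (s, a) :=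
    visits_mono pair _ (by omega)
  omega

end QLearning
end Game

/-! ### Azuma–Hoeffding for finitely supported conditional laws -/

section Concentration

/-- Hoeffding's lemma for a probability vector. -/
theorem expect_exp_le {S : Type*} [Fintype S] (p : stdSimplex ℝ S) {g : S → ℝ} {c : ℝ}
    (hg : ∀ s, |g s| ≤ c) (h0 : expect p g = 0) :
    expect p (fun s => Real.exp (g s)) ≤ Real.exp (c ^ 2 / 2) := by
  rcases le_or_gt c 0 with hc | hc
  · have h1 : ∀ s, g s = 0 := fun s => abs_nonpos_iff.1 ((hg s).trans hc)
    simp only [h1, Real.exp_zero, expect_const]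
    exact Real.one_le_exp (by positivity)
  -- On `[-c, c]` the exponential lies below its chord; the linear part of the chord has mean zero.
  · have h1 : ∀ s, Real.exp (g s) ≤ Real.cosh c + g s * (Real.sinh c / c) := by
      intro s
      have h2 := abs_le.1 (hg s)
      have h5 : 0 ≤ (c + g s) / (2 * c) := div_nonneg (by linarith) (by positivity)
      have h6 : 0 ≤ (c - g s) / (2 * c) := div_nonneg (by linarith) (by positivity)
      have h7 : (c + g s) / (2 * c) + (c - g s) / (2 * c) = 1 := by field_simp; ring
      have h3 := convexOn_exp.2 (Set.mem_univ c) (Set.mem_univ (-c)) h5 h6 h7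
      have h4 : (c + g s) / (2 * c) * c + (c - g s) / (2 * c) * -c = g s := by
        field_simp; ring
      simp only [smul_eq_mul, h4] at h3
      refine h3.trans_eq ?_
      rw [Real.cosh_eq, Real.sinh_eq]
      field_simp
      ring
    calc expect p (fun s => Real.exp (g s))
        ≤ expect p fun s => Real.cosh c + g s * (Real.sinh c / c) := expect_le_expect p h1
      _ = Real.cosh c := by
        have : expect p (fun s => Real.cosh c + g s * (Real.sinh c / c))
            = expect p (fun _ => Real.cosh c) + expect p g * (Real.sinh c / c) := by
          simp only [expect, mul_add, Finset.sum_add_distrib, Finset.sum_mul, mul_assoc]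
        rw [this, h0, expect_const, zero_mul, add_zero]
      _ ≤ Real.exp (c ^ 2 / 2) := Real.cosh_le_exp_half_sq c

variable {Ω : Type*} {m mΩ : MeasurableSpace Ω} {Pr : Measure Ω} [IsProbabilityMeasure Pr]

theorem measure_inter_eq_setLIntegral_of_condExp (hm : m ≤ mΩ) {E : Set Ω} (hE : MeasurableSet E)
    {p : Ω → ℝ} (hp : ∀ ω, 0 ≤ p ω) (h : Pr⟦E | m⟧ =ᵐ[Pr] p) {F : Set Ω}
    (hF : MeasurableSet[m] F) :
    Pr (E ∩ F) = ∫⁻ ω in F, ENNReal.ofReal (p ω) ∂Pr := by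
  have hint : Integrable p Pr := integrable_condExp.congr h
  have hE1 : Integrable (E.indicator fun _ => (1 : ℝ)) Pr :=
    (integrable_const (1 : ℝ)).indicator hE
  have h1 := setIntegral_condExp hm hE1 hF
  have h2 : ∫ ω in F, (Pr⟦E | m⟧) ω ∂Pr = ∫ ω in F, p ω ∂Pr :=
    integral_congr_ae (ae_restrict_of_ae h)
  have h3 : ∫ ω in F, E.indicator (fun _ => (1 : ℝ)) ω ∂Pr = Pr.real (E ∩ F) := by
    rw [integral_indicator hE, Measure.restrict_restrict hE]
    simp
  rw [← ofReal_integral_eq_lintegral_ofReal hint.restrict (Eventually.of_forall hp), ← h2, h1, h3,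
    Measure.real, ENNReal.ofReal_toReal (measure_ne_top _ _)]

/-- Restriction to `E` and the density `p` define the same measure on `m`, hence the same integrals
of `m`-measurable functions. -/
theorem setLIntegral_eq_of_condExp (hm : m ≤ mΩ) {E : Set Ω} (hE : MeasurableSet E)
    {p : Ω → ℝ} (hp : ∀ ω, 0 ≤ p ω) (hpm : Measurable[mΩ] p) (h : Pr⟦E | m⟧ =ᵐ[Pr] p)
    {g : Ω → ENNReal} (hg : Measurable[m] g) :
    ∫⁻ ω in E, g ω ∂Pr = ∫⁻ ω, ENNReal.ofReal (p ω) * g ω ∂Pr := by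
  have h1 : (Pr.restrict E).trim hm = (Pr.withDensity fun ω => ENNReal.ofReal (p ω)).trim hm := by
    refine @Measure.ext _ m _ _ fun F hF => ?_
    rw [trim_measurableSet_eq hm hF, trim_measurableSet_eq hm hF,
      Measure.restrict_apply (hm F hF), withDensity_apply _ (hm F hF), Set.inter_comm]
    exact measure_inter_eq_setLIntegral_of_condExp hm hE hp h hF
  rw [← lintegral_trim hm hg, h1, lintegral_trim hm hg,
    lintegral_withDensity_eq_lintegral_mul _ hpm.ennreal_ofReal (hg.mono hm le_rfl)]
  rfl

theorem measurable_apply_of_finite {Ω : Type*} {m : MeasurableSpace Ω} {S : Type*} [Fintype S]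
    [MeasurableSpace S] [MeasurableSingletonClass S] {h : Ω → S → ℝ}
    (hh : ∀ s, Measurable fun ω => h ω s) {f : Ω → S} (hf : Measurable f) :
    Measurable fun ω => h ω (f ω) := by
  classical
  have h1 : (fun ω => h ω (f ω)) = fun ω => ∑ s, (f ⁻¹' {s}).indicator (fun ω => h ω s) ω := by
    funext ω
    rw [Finset.sum_eq_single (f ω)]
    · simp
    · intro s _ hs
      simp [Ne.symm hs]
    · simp
  rw [h1]
  exact Finset.measurable_fun_sum _ fun s _ => (hh s).indicator (hf (measurableSet_singleton s))

variable {S : Type*} [Fintype S] [MeasurableSpace S] [MeasurableSingletonClass S]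

theorem measurable_expect {Ω : Type*} {m : MeasurableSpace Ω} {p : Ω → stdSimplex ℝ S}
    (hp : ∀ s, Measurable fun ω => (p ω).1 s) {h : Ω → S → ℝ}
    (hh : ∀ s, Measurable fun ω => h ω s) : Measurable fun ω => expect (p ω) (h ω) :=
  Finset.measurable_fun_sum _ fun s _ => (hp s).mul (hh s)

/-- The deviation of `h` at the random point `f` from its mean under `p`, times `c`. -/
def deviation (c : Ω → ℝ) (h : Ω → S → ℝ) (p : Ω → stdSimplex ℝ S) (f : Ω → S) (ω : Ω) : ℝ :=
  c ω * (h ω (f ω) - expect (p ω) (h ω))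

/-- One step of the supermartingale argument. Splitting by the finitely many values of `f`, each
conditional probability is replaced by `p`, after which Hoeffding's lemma applies for each `ω`. -/
theorem lintegral_mul_exp_deviation_le (hm : m ≤ mΩ) {c : Ω → ℝ} {h : Ω → S → ℝ}
    {p : Ω → stdSimplex ℝ S} {f : Ω → S} {b : ℝ} (hc : Measurable[m] c)
    (hh : ∀ s, Measurable[m] fun ω => h ω s) (hp : ∀ s, Measurable[m] fun ω => (p ω).1 s)
    (hf : Measurable[mΩ] f) (hb : ∀ ω s, |h ω s| ≤ b)
    (hlaw : ∀ s, Pr⟦f ⁻¹' {s} | m⟧ =ᵐ[Pr] fun ω => (p ω).1 s)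
    {Y : Ω → ENNReal} (hY : Measurable[m] Y) :
    ∫⁻ ω, Y ω * ENNReal.ofReal (Real.exp (deviation c h p f ω)) ∂Pr
      ≤ ∫⁻ ω, Y ω * ENNReal.ofReal (Real.exp ((2 * b * c ω) ^ 2 / 2)) ∂Pr := by
  classical
  have hmean : Measurable[m] fun ω => expect (p ω) (h ω) := measurable_expect hp hh
  let g : S → Ω → ENNReal := fun s ω =>
    Y ω * ENNReal.ofReal (Real.exp (c ω * (h ω s - expect (p ω) (h ω))))
  have hg : ∀ s, Measurable[m] (g s) := fun s =>
    hY.mul (((hc.mul ((hh s).sub hmean)).exp).ennreal_ofReal)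
  have h1 : ∀ ω, Y ω * ENNReal.ofReal (Real.exp (deviation c h p f ω))
      = ∑ s, (f ⁻¹' {s}).indicator (g s) ω := by
    intro ω
    rw [Finset.sum_eq_single (f ω)]
    · simp [g, deviation]
    · intro s _ hs
      simp [Ne.symm hs]
    · simp
  have hfm : ∀ s, MeasurableSet (f ⁻¹' {s}) := fun s => hf (measurableSet_singleton s)
  simp only [h1]
  rw [lintegral_finsetSum _ fun s _ => ((hg s).mono hm le_rfl).indicator (hfm s)]
  calc ∑ s, ∫⁻ ω, (f ⁻¹' {s}).indicator (g s) ω ∂Pr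
      = ∑ s, ∫⁻ ω, ENNReal.ofReal ((p ω).1 s) * g s ω ∂Pr := by
        refine Finset.sum_congr rfl fun s _ => ?_
        rw [lintegral_indicator (hfm s)]
        exact setLIntegral_eq_of_condExp hm (hfm s) (fun ω => (p ω).2.1 s)
          ((hp s).mono hm le_rfl) (hlaw s) (hg s)
    _ = ∫⁻ ω, ∑ s, ENNReal.ofReal ((p ω).1 s) * g s ω ∂Pr := by
        exact (lintegral_finsetSum _ fun s _ =>
          (((hp s).mono hm le_rfl).ennreal_ofReal).mul ((hg s).mono hm le_rfl)).symm
    _ ≤ _ := by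
        refine lintegral_mono fun ω => ?_
        have h2 : ∑ s, ENNReal.ofReal ((p ω).1 s) * g s ω
            = Y ω * ENNReal.ofReal
              (expect (p ω) fun s => Real.exp (c ω * (h ω s - expect (p ω) (h ω)))) := by
          rw [expect, ENNReal.ofReal_sum_of_nonneg fun s _ =>
            mul_nonneg ((p ω).2.1 s) (Real.exp_pos _).le, Finset.mul_sum]
          refine Finset.sum_congr rfl fun s _ => ?_
          rw [ENNReal.ofReal_mul ((p ω).2.1 s)]
          simp only [g]
          ring
        rw [h2]
        refine mul_le_mul_right (ENNReal.ofReal_le_ofReal ?_) _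
        have h3 : |expect (p ω) (h ω)| ≤ b := abs_expect_le _ (hb ω)
        refine (expect_exp_le (p ω) (c := 2 * b * |c ω|) (fun s => ?_) ?_).trans_eq ?_
        · rw [abs_mul, mul_comm]
          refine mul_le_mul_of_nonneg_right ?_ (abs_nonneg _)
          have := abs_sub (h ω s) (expect (p ω) (h ω))
          linarith [hb ω s]
        · have h4 : expect (p ω) (fun s => c ω * (h ω s - expect (p ω) (h ω)))
              = c ω * expect (p ω) fun s => h ω s - expect (p ω) (h ω) := by
            simp only [expect, Finset.mul_sum]
            exact Finset.sum_congr rfl fun s _ => by ring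
          rw [h4, ← expect_sub, expect_const, sub_self, mul_zero]
        · rw [mul_pow (2 * b), sq_abs, ← mul_pow]

variable {ℱ : Filtration ℕ mΩ} {c : ℕ → Ω → ℝ} {h : ℕ → Ω → S → ℝ}
    {p : ℕ → Ω → stdSimplex ℝ S} {f : ℕ → Ω → S} {b v : ℝ} {T : ℕ}

theorem measurable_deviation (hc : ∀ t < T, Measurable[ℱ t] (c t))
    (hh : ∀ t < T, ∀ s, Measurable[ℱ t] fun ω => h t ω s)
    (hp : ∀ t < T, ∀ s, Measurable[ℱ t] fun ω => (p t ω).1 s)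
    (hf : ∀ t < T, Measurable[ℱ (t + 1)] (f t)) {t : ℕ} (ht : t < T) :
    Measurable[ℱ (t + 1)] (deviation (c t) (h t) (p t) (f t)) := by
  have hle : ℱ t ≤ ℱ (t + 1) := ℱ.mono (Nat.le_succ t)
  have h1 : Measurable[ℱ (t + 1)] fun ω => h t ω (f t ω) :=
    measurable_apply_of_finite (fun s => (hh t ht s).mono hle le_rfl) (hf t ht)
  have h2 : Measurable[ℱ t] fun ω => expect (p t ω) (h t ω) :=
    measurable_expect (hp t ht) (hh t ht)
  exact ((hc t ht).mono hle le_rfl).mul (h1.sub (h2.mono hle le_rfl))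

/-- The Azuma–Hoeffding bound for the moment generating function. -/
theorem lintegral_exp_sum_deviation_le (hc : ∀ t < T, Measurable[ℱ t] (c t))
    (hh : ∀ t < T, ∀ s, Measurable[ℱ t] fun ω => h t ω s)
    (hp : ∀ t < T, ∀ s, Measurable[ℱ t] fun ω => (p t ω).1 s)
    (hf : ∀ t < T, Measurable[ℱ (t + 1)] (f t)) (hb : ∀ t < T, ∀ ω s, |h t ω s| ≤ b)
    (hlaw : ∀ t < T, ∀ s, Pr⟦f t ⁻¹' {s} | ℱ t⟧ =ᵐ[Pr] fun ω => (p t ω).1 s)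
    (hv : ∀ ω, ∑ t ∈ Finset.range T, c t ω ^ 2 ≤ v) :
    ∫⁻ ω, ENNReal.ofReal (Real.exp
        (∑ t ∈ Finset.range T, deviation (c t) (h t) (p t) (f t) ω)) ∂Pr
      ≤ ENNReal.ofReal (Real.exp ((2 * b) ^ 2 * v / 2)) := by
  -- The `c t` are random, so the compensator is kept inside the exponential, where it is
  -- predictable. The uniform bound `v` on the sum of squares enters only afterwards.
  have key : ∀ n ≤ T, ∫⁻ ω, ENNReal.ofReal (Real.exp (∑ t ∈ Finset.range n,
      (deviation (c t) (h t) (p t) (f t) ω - (2 * b * c t ω) ^ 2 / 2))) ∂Pr ≤ 1 := by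
    intro n
    induction n with
    | zero => intro _; simp
    | succ n ih =>
      intro hn
      have hn' : n < T := hn
      let Y : Ω → ENNReal := fun ω => ENNReal.ofReal (Real.exp (∑ t ∈ Finset.range n,
        (deviation (c t) (h t) (p t) (f t) ω - (2 * b * c t ω) ^ 2 / 2)
          - (2 * b * c n ω) ^ 2 / 2))
      have hY : Measurable[ℱ n] Y := by
        refine Measurable.ennreal_ofReal (Measurable.exp ?_)
        have hcn : ∀ t ≤ n, Measurable[ℱ n] fun ω => (2 * b * c t ω) ^ 2 / 2 := fun t ht =>
          ((((hc t (by omega)).mono (ℱ.mono ht) le_rfl).const_mul (2 * b)).pow_const 2).div_const 2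
        refine Measurable.sub (Finset.measurable_fun_sum _ fun t ht => ?_) (hcn n le_rfl)
        have ht' : t < n := Finset.mem_range.1 ht
        exact ((measurable_deviation hc hh hp hf (by omega : t < T)).mono
          (ℱ.mono ht') le_rfl).sub (hcn t ht'.le)
      calc _ = ∫⁻ ω, Y ω * ENNReal.ofReal
              (Real.exp (deviation (c n) (h n) (p n) (f n) ω)) ∂Pr := by
            refine lintegral_congr fun ω => ?_
            rw [← ENNReal.ofReal_mul (Real.exp_pos _).le, ← Real.exp_add, Finset.sum_range_succ]
            congr 2
            ring
        _ ≤ ∫⁻ ω, Y ω * ENNReal.ofReal (Real.exp ((2 * b * c n ω) ^ 2 / 2)) ∂Pr :=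
            lintegral_mul_exp_deviation_le (ℱ.le n) (hc n hn') (hh n hn') (hp n hn')
              ((hf n hn').mono (ℱ.le _) le_rfl) (hb n hn') (hlaw n hn') hY
        _ = _ := by
            refine lintegral_congr fun ω => ?_
            rw [← ENNReal.ofReal_mul (Real.exp_pos _).le, ← Real.exp_add, sub_add_cancel]
        _ ≤ 1 := ih (by omega)
  calc _ ≤ ∫⁻ ω, ENNReal.ofReal (Real.exp ((2 * b) ^ 2 * v / 2))
          * ENNReal.ofReal (Real.exp (∑ t ∈ Finset.range T,
            (deviation (c t) (h t) (p t) (f t) ω - (2 * b * c t ω) ^ 2 / 2))) ∂Pr := by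
        refine lintegral_mono fun ω => ?_
        rw [← ENNReal.ofReal_mul (Real.exp_pos _).le, ← Real.exp_add]
        refine ENNReal.ofReal_le_ofReal (Real.exp_le_exp.2 ?_)
        have h1 : ∑ t ∈ Finset.range T, (2 * b * c t ω) ^ 2 / 2
            = (2 * b) ^ 2 / 2 * ∑ t ∈ Finset.range T, c t ω ^ 2 := by
          rw [Finset.mul_sum]
          exact Finset.sum_congr rfl fun t _ => by ring
        rw [Finset.sum_sub_distrib, h1]
        have := mul_le_mul_of_nonneg_left (hv ω) (show 0 ≤ (2 * b) ^ 2 / 2 by positivity)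
        linarith
    _ = ENNReal.ofReal (Real.exp ((2 * b) ^ 2 * v / 2)) * _ :=
        lintegral_const_mul' _ _ ENNReal.ofReal_ne_top
    _ ≤ _ := mul_le_of_le_one_right zero_le (key T le_rfl)

theorem measure_le_sum_deviation_le (hc : ∀ t < T, Measurable[ℱ t] (c t))
    (hh : ∀ t < T, ∀ s, Measurable[ℱ t] fun ω => h t ω s)
    (hp : ∀ t < T, ∀ s, Measurable[ℱ t] fun ω => (p t ω).1 s)
    (hf : ∀ t < T, Measurable[ℱ (t + 1)] (f t)) (hb : ∀ t < T, ∀ ω s, |h t ω s| ≤ b)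
    (hlaw : ∀ t < T, ∀ s, Pr⟦f t ⁻¹' {s} | ℱ t⟧ =ᵐ[Pr] fun ω => (p t ω).1 s)
    (hv : ∀ ω, ∑ t ∈ Finset.range T, c t ω ^ 2 ≤ v) (hb0 : 0 < b) (hv0 : 0 < v) {u : ℝ}
    (hu : 0 < u) :
    Pr {ω | u ≤ ∑ t ∈ Finset.range T, deviation (c t) (h t) (p t) (f t) ω}
      ≤ ENNReal.ofReal (Real.exp (-(u ^ 2 / (8 * b ^ 2 * v)))) := by
  -- The minimizer of the Chernoff exponent `2 b² v l² - l u`.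
  set l := u / (4 * b ^ 2 * v) with hl
  have hl0 : 0 < l := by positivity
  have h1 := lintegral_exp_sum_deviation_le (Pr := Pr) (c := fun t ω => l * c t ω) (v := l ^ 2 * v)
    (fun t ht => (hc t ht).const_mul l) hh hp hf hb hlaw (fun ω => by
      simp only [mul_pow, ← Finset.mul_sum]
      exact mul_le_mul_of_nonneg_left (hv ω) (by positivity))
  have h2 : ∀ ω, ∑ t ∈ Finset.range T, deviation (fun ω => l * c t ω) (h t) (p t) (f t) ω
      = l * ∑ t ∈ Finset.range T, deviation (c t) (h t) (p t) (f t) ω := by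
    intro ω
    rw [Finset.mul_sum]
    exact Finset.sum_congr rfl fun t _ => by simp only [deviation]; ring
  simp only [h2] at h1
  have hX : Measurable[mΩ] fun ω =>
      ∑ t ∈ Finset.range T, deviation (c t) (h t) (p t) (f t) ω :=
    Finset.measurable_fun_sum _ fun t ht =>
      (measurable_deviation hc hh hp hf (Finset.mem_range.1 ht)).mono (ℱ.le _) le_rfl
  have h3 : Pr {ω | u ≤ ∑ t ∈ Finset.range T, deviation (c t) (h t) (p t) (f t) ω}
      ≤ Pr {ω | 1 ≤ ENNReal.ofReal (Real.exp (-(l * u))) * ENNReal.ofReal (Real.exp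
        (l * ∑ t ∈ Finset.range T, deviation (c t) (h t) (p t) (f t) ω))} := by
    refine measure_mono fun ω hω => ?_
    simp only [Set.mem_ofPred_eq] at hω ⊢
    rw [← ENNReal.ofReal_mul (Real.exp_pos _).le, ← Real.exp_add, ENNReal.one_le_ofReal]
    refine Real.one_le_exp ?_
    nlinarith
  have h4 := mul_meas_ge_le_lintegral (μ := Pr)
    (f := fun ω => ENNReal.ofReal (Real.exp (-(l * u))) * ENNReal.ofReal (Real.exp
        (l * ∑ t ∈ Finset.range T, deviation (c t) (h t) (p t) (f t) ω)))
    (((hX.const_mul l).exp.ennreal_ofReal).const_mul _) 1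
  rw [one_mul, lintegral_const_mul' _ _ ENNReal.ofReal_ne_top] at h4
  refine h3.trans (h4.trans ((mul_le_mul_right h1 _).trans_eq ?_))
  rw [← ENNReal.ofReal_mul (Real.exp_pos _).le, ← Real.exp_add]
  congr 2
  rw [hl]
  field_simp
  ring

theorem measure_le_abs_sum_deviation_le (hc : ∀ t < T, Measurable[ℱ t] (c t))
    (hh : ∀ t < T, ∀ s, Measurable[ℱ t] fun ω => h t ω s)
    (hp : ∀ t < T, ∀ s, Measurable[ℱ t] fun ω => (p t ω).1 s)
    (hf : ∀ t < T, Measurable[ℱ (t + 1)] (f t)) (hb : ∀ t < T, ∀ ω s, |h t ω s| ≤ b)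
    (hlaw : ∀ t < T, ∀ s, Pr⟦f t ⁻¹' {s} | ℱ t⟧ =ᵐ[Pr] fun ω => (p t ω).1 s)
    (hv : ∀ ω, ∑ t ∈ Finset.range T, c t ω ^ 2 ≤ v) (hb0 : 0 < b) (hv0 : 0 < v) {u : ℝ}
    (hu : 0 < u) :
    Pr {ω | u ≤ |∑ t ∈ Finset.range T, deviation (c t) (h t) (p t) (f t) ω|}
      ≤ ENNReal.ofReal (2 * Real.exp (-(u ^ 2 / (8 * b ^ 2 * v)))) := by
  have h1 := measure_le_sum_deviation_le (Pr := Pr) hc hh hp hf hb hlaw hv hb0 hv0 hu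
  have h2 := measure_le_sum_deviation_le (Pr := Pr) (c := fun t ω => -c t ω)
    (fun t ht => (hc t ht).neg) hh hp hf hb hlaw (by simpa using hv) hb0 hv0 hu
  have h3 : ∀ ω, ∑ t ∈ Finset.range T, deviation (fun ω => -c t ω) (h t) (p t) (f t) ω
      = -∑ t ∈ Finset.range T, deviation (c t) (h t) (p t) (f t) ω := by
    intro ω
    rw [← Finset.sum_neg_distrib]
    exact Finset.sum_congr rfl fun t _ => by simp only [deviation]; ring
  simp only [h3] at h2
  have h4 : {ω | u ≤ |∑ t ∈ Finset.range T, deviation (c t) (h t) (p t) (f t) ω|}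
      ⊆ {ω | u ≤ ∑ t ∈ Finset.range T, deviation (c t) (h t) (p t) (f t) ω}
        ∪ {ω | u ≤ -∑ t ∈ Finset.range T, deviation (c t) (h t) (p t) (f t) ω} := by
    intro ω hω
    exact le_abs.1 (Set.mem_ofPred_eq ▸ hω)
  refine (measure_mono h4).trans ((measure_union_le _ _).trans ((add_le_add h1 h2).trans_eq ?_))
  rw [← ENNReal.ofReal_add (Real.exp_pos _).le (Real.exp_pos _).le]
  congr 1
  ring

end Concentration

/-! ### Measurability of the greedy action -/

section Measurability

theorem measurable_greedy {Ω : Type*} {m : MeasurableSpace Ω} {A : Type*} [Fintype A] [Nonempty A]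
    [Lattice A] [MeasurableSpace A] {f : Ω → A → ℝ} (hf : ∀ a, Measurable fun ω => f ω a) :
    Measurable fun ω => greedy (f ω) := by
  classical
  -- The greedy action, including the arbitrary choice in the fallback case, depends on `f` only
  -- through its set of maximizers, which takes finitely many values.
  obtain ⟨ψ, hψ⟩ : ∃ ψ : Finset A → A, ∀ f : A → ℝ, greedy f = ψ (maximizers f) := by
    refine ⟨fun F => if hF : F.Nonempty then
      (if F.sup' hF id ∈ F then F.sup' hF id else Exists.choose (p := (· ∈ F)) hF)
      else Classical.arbitrary A, fun f => ?_⟩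
    simp only [maximizers_nonempty f, dite_true, greedy]
  simp only [hψ]
  let _ : MeasurableSpace (Finset A) := ⊤
  refine measurable_from_top.comp (measurable_to_countable' fun F => ?_)
  have h1 : (fun ω => maximizers (f ω)) ⁻¹' {F}
      = ⋂ a, {ω | (∀ b, f ω b ≤ f ω a) ↔ a ∈ F} := by
    ext ω
    simp [Finset.ext_iff, mem_maximizers]
  rw [h1]
  refine MeasurableSet.iInter fun a => ?_
  refine MeasurableSet.iff ?_ (MeasurableSet.const _)
  have h2 : {ω | ∀ b, f ω b ≤ f ω a} = ⋂ b, {ω | f ω b ≤ f ω a} := by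
    ext ω
    simp
  rw [h2]
  exact MeasurableSet.iInter fun b => measurableSet_le (hf b) (hf a)

end Measurability

namespace Game

variable {S A : Type*} [Fintype S] [DecidableEq S] [Lattice S]
  [Fintype A] [DecidableEq A] [Lattice A] [Nontrivial A]
  [MeasurableSpace S] [MeasurableSingletonClass S]
  [MeasurableSpace A] [MeasurableSingletonClass A] {M : Game S A} {C₁ C₂ C₃ w : ℝ}

/-- Measurability in the mean field is not part of a game; it comes from the Lipschitz conditions.
-/
theorem IsLipschitz.measurable_r (hL : M.IsLipschitz C₁ C₂ C₃) (s : S) (a : A) :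
    Measurable (M.r s a) :=
  (continuous_of_abs_sub_le_l1dist (hL.reward s a)).measurable

theorem IsLipschitz.measurable_P (hL : M.IsLipschitz C₁ C₂ C₃) (s : S) (a : A) (s' : S) :
    Measurable fun z => (M.P s a z).1 s' := by
  refine (continuous_of_abs_sub_le_l1dist (C := C₂) fun z z' => ?_).measurable
  refine le_trans ?_ (hL.trans s a z z')
  exact Finset.single_le_sum (f := fun s' => |(M.P s a z).1 s' - (M.P s a z').1 s'|)
    (fun _ _ => abs_nonneg _) (Finset.mem_univ s')

section

variable {Ω : Type*} {m : MeasurableSpace Ω}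

theorem measurable_G {Q : Ω → S → A → ℝ} (hQ : ∀ s a, Measurable fun ω => Q ω s a) (s : S) :
    Measurable fun ω => M.G (Q ω) s := by
  simp only [G_eq]
  exact ((Finset.measurable_fun_sum _ fun a _ => hQ s a).const_mul _).add
    ((measurable_apply_of_finite (h := fun ω => Q ω s) (hQ s)
      (measurable_greedy (hQ s))).const_mul _)

theorem measurable_trembling {Q : Ω → S → A → ℝ} (hQ : ∀ s a, Measurable fun ω => Q ω s a)
    (s : S) (a : A) : Measurable fun ω => (M.trembling (Q ω) s).1 a := by
  simp only [trembling, tremble]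
  exact Measurable.ite ((measurable_greedy (hQ s)) (measurableSet_singleton a) |>.congr (by
    ext ω; simp [eq_comm])) measurable_const measurable_const

variable {pair : ℕ → Ω → S × A} {next : ℕ → Ω → S} {z : Ω → stdSimplex ℝ S} {t : ℕ}

theorem measurableSet_pair_eq (hpair : Measurable (pair t)) (x : S × A) :
    MeasurableSet {ω | pair t ω = x} :=
  hpair (measurableSet_singleton x)

theorem measurable_visits (hpair : ∀ j < t, Measurable (pair j)) (x : S × A) :
    Measurable fun ω => visits (fun j => pair j ω) t x := by
  induction t with
  | zero => simp only [visits, Finset.range_zero, Finset.filter_empty]; exact measurable_const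
  | succ t ih =>
    simp only [visits_succ]
    exact (ih fun j hj => hpair j (by omega)).add (Measurable.ite
      (measurableSet_pair_eq (hpair t (by omega)) x) measurable_const measurable_const)

theorem measurable_weight (hpair : ∀ j ≤ t, Measurable (pair j)) (n : ℕ) (x : S × A) :
    Measurable fun ω => weight (fun j => pair j ω) w n x t := by
  have hv := measurable_visits (fun j hj => hpair j (Nat.le_of_lt hj)) x
  refine Measurable.ite (measurableSet_pair_eq (hpair t le_rfl) x) ?_ measurable_const
  exact (measurable_from_top (f := fun i => if i < n then eta w n i else 0)).comp hv

theorem IsLipschitz.measurable_qIter (hL : M.IsLipschitz C₁ C₂ C₃) (hz : Measurable z)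
    (hpair : ∀ j < t, Measurable (pair j)) (hnext : ∀ j < t, Measurable (next j)) (s : S) (a : A) :
    Measurable fun ω => M.qIter w (z ω) (fun j => pair j ω) (fun j => next j ω) t s a := by
  induction t generalizing s a with
  | zero => exact measurable_const
  | succ t ih =>
    have ih' := ih (fun j hj => hpair j (by omega)) (fun j hj => hnext j (by omega))
    have hl : Measurable fun ω => lr w (visits (fun j => pair j ω) t (s, a)) :=
      (measurable_from_top (f := lr w)).comp
        (measurable_visits (fun j hj => hpair j (by omega)) (s, a))
    simp only [qIter_succ, eq_comm (a := (s, a))]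
    refine Measurable.ite (measurableSet_pair_eq (hpair t (by omega)) (s, a)) ?_ (ih' s a)
    refine ((measurable_const.sub hl).mul (ih' s a)).add (hl.mul
      (((hL.measurable_r s a).comp hz).add (Measurable.const_mul ?_ _)))
    exact measurable_apply_of_finite (fun s' => measurable_G ih' s') (hnext t (by omega))

theorem IsLipschitz.measurable_P_pair (hL : M.IsLipschitz C₁ C₂ C₃) (hz : Measurable z)
    (hpair : Measurable (pair t)) (s' : S) :
    Measurable fun ω => (M.P (pair t ω).1 (pair t ω).2 (z ω)).1 s' :=
  measurable_apply_of_finite (h := fun ω (x : S × A) => (M.P x.1 x.2 (z ω)).1 s')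
    (fun x => (hL.measurable_P x.1 x.2 s').comp hz) hpair

theorem IsLipschitz.measurable_Phi (hL : M.IsLipschitz C₁ C₂ C₃) (hz : Measurable z)
    {μ : Ω → Strategy S A} (hμ : ∀ s a, Measurable fun ω => (μ ω s).1 a) (s' : S) :
    Measurable fun ω => (M.Phi (z ω) (μ ω)).1 s' := by
  refine Finset.measurable_fun_sum _ fun s _ => Finset.measurable_fun_sum _ fun a _ => ?_
  exact ((((measurable_pi_apply s).comp measurable_subtype_coe).comp hz).mul (hμ s a)).mul
    ((hL.measurable_P s a s').comp hz)

end

/-! ### Concentration of the averaged noise -/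

section Noise

variable {Ω : Type*} {mΩ : MeasurableSpace Ω} {Pr : Measure Ω} [IsProbabilityMeasure Pr]
  {ℱ : Filtration ℕ mΩ} {z : Ω → stdSimplex ℝ S} {pair : ℕ → Ω → S × A} {next : ℕ → Ω → S} {T : ℕ}

/-- For a fixed visit number `n` the weight at time `j` is known at time `j`, since it depends on
the past visits and the current pair only. With the random final visit count in place of `n` this
would fail. -/
theorem IsLipschitz.measure_le_abs_sum_noise_le (hL : M.IsLipschitz C₁ C₂ C₃) (hw : 0 ≤ w)
    (hw' : w ≤ 1) (hz : Measurable[ℱ 0] z) (hpair : ∀ t < T, Measurable[ℱ t] (pair t))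
    (hnext : ∀ t < T, Measurable[ℱ (t + 1)] (next t))
    (hlaw : ∀ t < T, ∀ s', Pr⟦next t ⁻¹' {s'} | ℱ t⟧ =ᵐ[Pr]
      fun ω => (M.P (pair t ω).1 (pair t ω).2 (z ω)).1 s')
    {n : ℕ} (hn : 0 < n) (x : S × A) {u : ℝ} (hu : 0 < u) :
    Pr {ω | u ≤ |∑ j ∈ Finset.range T, weight (fun j => pair j ω) w n x j
        * M.noise (z ω) (fun j => pair j ω) (fun j => next j ω) w j|}
      ≤ ENNReal.ofReal (2 * Real.exp (-(u ^ 2 * (n : ℝ) ^ w / (8 * M.vmax ^ 2)))) := by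
  have hv0 : 0 < M.vmax := zero_lt_one.trans_le M.one_le_vmax
  have hn0 : (0 : ℝ) < (n : ℝ) ^ w := by positivity
  have hpair' : ∀ t, ∀ j < T, j ≤ t → Measurable[ℱ t] (pair j) := fun t j hj hjt =>
    (hpair j hj).mono (ℱ.mono hjt) le_rfl
  have h1 := measure_le_abs_sum_deviation_le (Pr := Pr) (ℱ := ℱ) (T := T)
    (c := fun t ω => weight (fun j => pair j ω) w n x t)
    (h := fun t ω s => M.γ * M.G (M.qIter w (z ω) (fun j => pair j ω) (fun j => next j ω) t) s)
    (p := fun t ω => M.P (pair t ω).1 (pair t ω).2 (z ω)) (f := next) (b := M.vmax)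
    (v := 1 / (n : ℝ) ^ w)
    (fun t ht => measurable_weight (fun j hj => hpair' t j (by omega) hj) n x)
    (fun t ht s => (measurable_G (hL.measurable_qIter (hz.mono (ℱ.mono (Nat.zero_le t)) le_rfl)
      (fun j hj => hpair' t j (by omega) hj.le) fun j hj =>
        (hnext j (by omega)).mono (ℱ.mono hj) le_rfl) s).const_mul _)
    (fun t ht s => hL.measurable_P_pair (hz.mono (ℱ.mono (Nat.zero_le t)) le_rfl) (hpair t ht) s)
    hnext (fun t ht ω s => ?_) hlaw (fun ω => sum_weight_sq_le _ hw hw' n x T) hv0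
    (by positivity) hu
  · refine le_trans (le_of_eq ?_) (h1.trans (le_of_eq ?_))
    · congr 1
      ext ω
      have h2 : ∀ t, weight (fun j => pair j ω) w n x t
          * M.noise (z ω) (fun j => pair j ω) (fun j => next j ω) w t
          = deviation (fun ω => weight (fun j => pair j ω) w n x t)
            (fun ω s => M.γ * M.G (M.qIter w (z ω) (fun j => pair j ω) (fun j => next j ω) t) s)
            (fun ω => M.P (pair t ω).1 (pair t ω).2 (z ω)) (next t) ω := by
        intro t
        simp only [deviation, noise, expect]
        rw [mul_sub M.γ, Finset.mul_sum]
        congr 2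
        exact Finset.sum_congr rfl fun s _ => by ring
      simp only [Set.mem_ofPred_eq, h2]
    · congr 3
      field_simp
  · rw [abs_mul, abs_of_nonneg M.γ_nonneg]
    exact (mul_le_of_le_one_left (abs_nonneg _) M.γ_lt.le).trans
      (M.abs_G_le fun a => M.abs_qIter_le _ _ _ hw t s a)

/-- With high probability the averaged noise is small for all pairs and all visit numbers `≥ n₀`. -/
theorem IsLipschitz.measure_noise_event_le (hL : M.IsLipschitz C₁ C₂ C₃) (hw : 0 ≤ w)
    (hw' : w ≤ 1) (hz : Measurable[ℱ 0] z) (hpair : ∀ t < T, Measurable[ℱ t] (pair t))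
    (hnext : ∀ t < T, Measurable[ℱ (t + 1)] (next t))
    (hlaw : ∀ t < T, ∀ s', Pr⟦next t ⁻¹' {s'} | ℱ t⟧ =ᵐ[Pr]
      fun ω => (M.P (pair t ω).1 (pair t ω).2 (z ω)).1 s')
    {n₀ : ℕ} {u d : ℝ} (hu : 0 < u) (hd : 0 ≤ d)
    (hn₀ : ∀ n : ℕ, n₀ ≤ n + 1 → 2 * Real.exp (-(u ^ 2 * ((n : ℝ) + 1) ^ w / (8 * M.vmax ^ 2)))
      ≤ d / ((Fintype.card S * Fintype.card A : ℕ) : ℝ) * (1 / ((n : ℝ) + 1) - 1 / ((n : ℝ) + 2))) :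
    Pr {ω | ∃ (x : S × A) (n : ℕ), n < T ∧ n₀ ≤ n + 1 ∧
        u ≤ |∑ j ∈ Finset.range T, weight (fun j => pair j ω) w (n + 1) x j
          * M.noise (z ω) (fun j => pair j ω) (fun j => next j ω) w j|}
      ≤ ENNReal.ofReal d := by
  set N : ℝ := ((Fintype.card S * Fintype.card A : ℕ) : ℝ) with hN
  let E : S × A → ℕ → Set Ω := fun x n => if n₀ ≤ n + 1 then
    {ω | u ≤ |∑ j ∈ Finset.range T, weight (fun j => pair j ω) w (n + 1) x j
          * M.noise (z ω) (fun j => pair j ω) (fun j => next j ω) w j|} else ∅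
  have hg : ∀ n : ℕ, 0 ≤ 1 / ((n : ℝ) + 1) - 1 / ((n : ℝ) + 2) := fun n =>
    sub_nonneg.2 (one_div_le_one_div_of_le (by positivity) (by linarith))
  -- Each pair gets the budget `d / N`, spread over visit numbers by weights that telescope to less
  -- than 1, whatever the horizon.
  have hE : ∀ x n, Pr (E x n)
      ≤ ENNReal.ofReal (d / N * (1 / ((n : ℝ) + 1) - 1 / ((n : ℝ) + 2))) := by
    intro x n
    by_cases h : n₀ ≤ n + 1
    · simp only [E, if_pos h]
      refine (hL.measure_le_abs_sum_noise_le hw hw' hz hpair hnext hlaw (Nat.succ_pos n) x hu).trans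
        (ENNReal.ofReal_le_ofReal ?_)
      push_cast
      exact hn₀ n h
    · simp [E, if_neg h]
  have hsub : {ω | ∃ (x : S × A) (n : ℕ), n < T ∧ n₀ ≤ n + 1 ∧
        u ≤ |∑ j ∈ Finset.range T, weight (fun j => pair j ω) w (n + 1) x j
          * M.noise (z ω) (fun j => pair j ω) (fun j => next j ω) w j|}
      ⊆ ⋃ x ∈ (Finset.univ : Finset (S × A)), ⋃ n ∈ Finset.range T, E x n := by
    rintro ω ⟨x, n, hnT, hn, h⟩
    simp only [Set.mem_iUnion]
    refine ⟨x, Finset.mem_univ x, n, Finset.mem_range.2 hnT, ?_⟩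
    simp only [E, if_pos hn]
    exact h
  refine (measure_mono hsub).trans ((measure_biUnion_finset_le _ _).trans ?_)
  have hdN : 0 ≤ d / N := div_nonneg hd (by positivity)
  have hx : ∀ x, Pr (⋃ n ∈ Finset.range T, E x n) ≤ ENNReal.ofReal (d / N) := by
    intro x
    refine (measure_biUnion_finset_le _ _).trans ((Finset.sum_le_sum fun n _ => hE x n).trans ?_)
    rw [← ENNReal.ofReal_sum_of_nonneg fun n _ => mul_nonneg hdN (hg n), ← Finset.mul_sum]
    refine ENNReal.ofReal_le_ofReal (mul_le_of_le_one_right hdN ?_)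
    have h1 : ∀ n : ℕ, 1 / ((n : ℝ) + 1) - 1 / ((n : ℝ) + 2)
        = 1 / ((n : ℝ) + 1) - 1 / (((n + 1 : ℕ) : ℝ) + 1) := by
      intro n; push_cast; ring
    simp only [h1]
    rw [Finset.sum_range_sub' (fun n : ℕ => 1 / ((n : ℝ) + 1))]
    simp only [Nat.cast_zero, zero_add, div_one]
    have : (0 : ℝ) ≤ 1 / ((T : ℝ) + 1) := by positivity
    linarith
  refine (Finset.sum_le_sum fun x _ => hx x).trans ?_
  rw [Finset.sum_const, Finset.card_univ, Fintype.card_prod, nsmul_eq_mul,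
    ← ENNReal.ofReal_natCast, ← ENNReal.ofReal_mul (by positivity), ← hN]
  refine ENNReal.ofReal_le_ofReal ?_
  rcases eq_or_ne N 0 with h | h
  · simpa [h] using hd
  · exact (mul_div_cancel₀ d h).le

end Noise

end Game

/-! ### How many steps suffice -/

section SampleSize

/-- With `q = x ^ w / (128 R)` the claim follows from `log (4 D x²) ≤ q`. Half of `q` absorbs `2 log
x`, up to a multiple of `1 + log R`; the lower bound on `x` makes the other half absorb the terms of
order `Λ`. The 128 comes from `u = β e / 4` and the 8 in Azuma's exponent. -/
theorem exists_const_two_mul_exp_le {w : ℝ} (hw : 0 < w) (hw' : w < 1) :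
    ∃ C : ℝ, 1 ≤ C ∧ ∀ R Λ D x : ℝ, 1 ≤ R → 1 ≤ Λ → 0 < D → Real.log D ≤ Λ →
      Real.log R ≤ 2 * Λ → 1 ≤ x → C * (R * Λ) ^ (1 / w) ≤ x →
      2 * Real.exp (-(x ^ w / (128 * R))) ≤ 1 / D * (1 / x - 1 / (x + 1)) := by
  set b := Real.log (512 / w) with hb
  have hb0 : 0 ≤ b := Real.log_nonneg (by rw [le_div_iff₀ hw]; linarith)
  set H := 256 * (3 + 2 / w * (b + 2)) with hH
  have hH1 : 1 ≤ H := by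
    have : 0 ≤ 2 / w * (b + 2) := by positivity
    linarith
  refine ⟨H ^ (1 / w), Real.one_le_rpow hH1 (by positivity), ?_⟩
  intro R Λ D x hR hΛ hD hDΛ hRΛ hx hCx
  have hR0 : 0 < R := by linarith
  have hΛ0 : 0 < Λ := by linarith
  have hx0 : 0 < x := by linarith
  set q := x ^ w / (128 * R) with hq
  have hq0 : 0 < q := by positivity
  have hxw : x ^ w = 128 * R * q := by rw [hq]; field_simp
  have h1 : H * (R * Λ) ≤ x ^ w := by
    have h2 := Real.rpow_le_rpow (by positivity) hCx hw.le
    rwa [← Real.mul_rpow (by linarith) (by positivity), ← Real.rpow_mul (by positivity),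
      one_div_mul_cancel hw.ne', Real.rpow_one] at h2
  have h3 : 2 * (3 + 2 / w * (b + 2)) * Λ ≤ q := by
    rw [hq, le_div_iff₀ (by positivity)]
    refine le_trans (le_of_eq ?_) h1
    rw [hH]; ring
  have h4 : 2 * Real.log x ≤ 2 / w * (b + Real.log R) + q / 2 := by
    have h5 : Real.log x = 1 / w * Real.log (x ^ w) := by
      rw [Real.log_rpow hx0]; field_simp
    -- The factor `w * q / 4` is isolated so that `log y ≤ y - 1`, multiplied by `2 / w`, costs
    -- exactly `q / 2`.
    have h6 : x ^ w = 512 / w * R * (w * q / 4) := by rw [hxw]; field_simp; ring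
    have h7 : Real.log (x ^ w) ≤ b + Real.log R + w * q / 4 := by
      rw [h6, Real.log_mul (by positivity) (by positivity),
        Real.log_mul (by positivity) (by positivity)]
      have := Real.log_le_sub_one_of_pos (show 0 < w * q / 4 by positivity)
      linarith
    rw [h5]
    have h8 := mul_le_mul_of_nonneg_left h7 (show 0 ≤ 2 / w by positivity)
    calc 2 * (1 / w * Real.log (x ^ w)) = 2 / w * Real.log (x ^ w) := by ring
      _ ≤ _ := h8
      _ = _ := by field_simp; ring
  have h9 : Real.log (4 * D * x ^ 2) ≤ q := by
    rw [Real.log_mul (by positivity) (by positivity), Real.log_mul (by norm_num) hD.ne',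
      Real.log_pow]
    push_cast
    have h10 : Real.log 4 ≤ 2 := by
      have : Real.log 4 = 2 * Real.log 2 := by
        rw [show (4 : ℝ) = 2 ^ 2 by norm_num, Real.log_pow]; push_cast; ring
      have := Real.log_two_lt_d9
      linarith
    have h11 : 2 / w * (b + Real.log R) ≤ 2 / w * (b + 2) * Λ := by
      rw [mul_assoc]
      refine mul_le_mul_of_nonneg_left ?_ (by positivity)
      nlinarith
    linarith
  have h12 : Real.exp (-q) ≤ 1 / (4 * D * x ^ 2) := by
    rw [Real.exp_neg, ← one_div]
    refine one_div_le_one_div_of_le (by positivity) ?_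
    rwa [← Real.log_le_iff_le_exp (by positivity)]
  have h13 : 1 / x - 1 / (x + 1) = 1 / (x * (x + 1)) := by field_simp; ring
  have h14 : 1 / (2 * x ^ 2) ≤ 1 / (x * (x + 1)) :=
    one_div_le_one_div_of_le (by positivity) (by nlinarith)
  calc 2 * Real.exp (-q) ≤ 2 * (1 / (4 * D * x ^ 2)) := by linarith
    _ = 1 / D * (1 / (2 * x ^ 2)) := by field_simp; ring
    _ ≤ _ := by
      rw [h13]
      exact mul_le_mul_of_nonneg_left h14 (by positivity)

/-- About `log (4 V / e) / β` phases of `L T ^ w` steps must fit into `T / 2`, which is a lower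
bound on `T ^ (1 - w)`. Keeping `V / e` away from 1 allows the additive constants, from `log 4` and
from rounding, to be absorbed into a multiple of `log (V / e)`. -/
theorem exists_phase_count {w : ℝ} (hw : 0 < w) (hw' : w < 1) :
    ∃ C : ℝ, 0 ≤ C ∧ ∀ (V β e : ℝ) (L T : ℕ), 1 ≤ V → 0 < β → β ≤ 1 → 0 < e →
      8 / 7 ≤ V / e → 1 ≤ T → C * (L / β * Real.log (V / e)) ^ (1 / (1 - w)) ≤ T →
      ∃ m k : ℕ, (T : ℝ) ^ w ≤ m ∧ (k : ℝ) * (L * m) ≤ T / 2 ∧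
        (1 - β) ^ k * (2 * V) ≤ e / 2 := by
  set κ := Real.log (8 / 7) with hκ
  have hκ0 : 0 < κ := Real.log_pos (by norm_num)
  set H := 4 * (1 + 3 / κ) with hH
  have hH0 : 0 < H := by positivity
  have hw1 : 0 < 1 - w := by linarith
  refine ⟨H ^ (1 / (1 - w)), by positivity, ?_⟩
  intro V β e L T hV hβ hβ1 he hVe hT hCT
  have hT0 : (1 : ℝ) ≤ T := by exact_mod_cast hT
  have hTpos : (0 : ℝ) < T := by linarith
  set l := Real.log (V / e) with hl
  have hκl : κ ≤ l := Real.log_le_log (by norm_num) hVe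
  have hl0 : 0 < l := hκ0.trans_le hκl
  have h1 : H * (L / β * l) ≤ (T : ℝ) ^ (1 - w) := by
    have h2 := Real.rpow_le_rpow (by positivity) hCT hw1.le
    rwa [← Real.mul_rpow hH0.le (by positivity), ← Real.rpow_mul (by positivity),
      one_div_mul_cancel hw1.ne', Real.rpow_one] at h2
  have hlog4 : Real.log (4 * V / e) ≤ 2 + l := by
    rw [mul_div_assoc, Real.log_mul (by norm_num) (by positivity)]
    have : Real.log 4 = 2 * Real.log 2 := by
      rw [show (4 : ℝ) = 2 ^ 2 by norm_num, Real.log_pow]; push_cast; ring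
    have := Real.log_two_lt_d9
    linarith
  have hlog0 : 0 ≤ Real.log (4 * V / e) := by
    refine Real.log_nonneg ?_
    rw [mul_div_assoc]; linarith
  refine ⟨⌈(T : ℝ) ^ w⌉₊, ⌈1 / β * Real.log (4 * V / e)⌉₊, Nat.le_ceil _, ?_, ?_⟩
  · have hm : (⌈(T : ℝ) ^ w⌉₊ : ℝ) ≤ 2 * (T : ℝ) ^ w := by
      have h3 : 1 ≤ (T : ℝ) ^ w := Real.one_le_rpow hT0 hw.le
      have h4 := Nat.ceil_lt_add_one (show 0 ≤ (T : ℝ) ^ w by positivity)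
      linarith
    have hk : (⌈1 / β * Real.log (4 * V / e)⌉₊ : ℝ) ≤ 1 / β * ((1 + 3 / κ) * l) := by
      have h4 := Nat.ceil_lt_add_one (show 0 ≤ 1 / β * Real.log (4 * V / e) by positivity)
      have h5 : 1 ≤ 1 / β := by rw [le_div_iff₀ hβ]; linarith
      have h6 : 1 / β * Real.log (4 * V / e) ≤ 1 / β * (2 + l) :=
        mul_le_mul_of_nonneg_left hlog4 (by positivity)
      have h7 : 3 ≤ 3 / κ * l := by
        rw [div_mul_eq_mul_div, le_div_iff₀ hκ0]; nlinarith
      have h8 : 1 / β * (3 + l) ≤ 1 / β * ((1 + 3 / κ) * l) :=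
        mul_le_mul_of_nonneg_left (by linarith) (by positivity)
      linarith
    calc (⌈1 / β * Real.log (4 * V / e)⌉₊ : ℝ) * (L * (⌈(T : ℝ) ^ w⌉₊ : ℝ))
        ≤ 1 / β * ((1 + 3 / κ) * l) * (L * (2 * (T : ℝ) ^ w)) := by gcongr
      _ = H * (L / β * l) * (T : ℝ) ^ w / 2 := by rw [hH]; ring
      _ ≤ (T : ℝ) ^ (1 - w) * (T : ℝ) ^ w / 2 := by gcongr
      _ = T / 2 := by rw [← Real.rpow_add hTpos]; simp
  · set k := ⌈1 / β * Real.log (4 * V / e)⌉₊ with hk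
    have h3 : Real.log (4 * V / e) ≤ β * k := by
      have := Nat.le_ceil (1 / β * Real.log (4 * V / e))
      rw [← hk, one_div, inv_mul_le_iff₀ hβ] at this
      exact this
    have h4 : (1 - β) ^ k ≤ e / (4 * V) := by
      calc (1 - β) ^ k ≤ Real.exp (-β) ^ k := by
            refine pow_le_pow_left₀ (by linarith) ?_ k
            have := Real.add_one_le_exp (-β)
            linarith
        _ = Real.exp (-(β * k)) := by rw [← Real.exp_nat_mul]; congr 1; ring
        _ ≤ Real.exp (-Real.log (4 * V / e)) := Real.exp_le_exp.2 (neg_le_neg h3)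
        _ = e / (4 * V) := by
            rw [Real.exp_neg, Real.exp_log (by positivity), inv_div]
    calc (1 - β) ^ k * (2 * V) ≤ e / (4 * V) * (2 * V) := by gcongr
      _ = e / 2 := by field_simp; norm_num

set_option maxHeartbeats 400000 in
/-- A number of steps of the order `qSteps` suffices for the noise to average out and for the
initial error to decay. The first alternative in the conclusion is the one in which a single visit
of each pair is enough. -/
theorem exists_const_qSteps {w : ℝ} (hw : 0 < w) (hw' : w < 1) :
    ∃ c : ℝ, 0 < c ∧ ∀ (γ : ℝ) (N L T : ℕ) (e d : ℝ), 0 ≤ γ → γ < 1 → 2 ≤ N → 1 ≤ L →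
      0 < e → e < 1 → 0 < d → d < 1 → c * qSteps w γ N L e d ≤ T →
      L ≤ T ∧ (2 * (γ * (1 / (1 - γ))) ≤ e ∨
        ∃ n₀ m k : ℕ, 0 < n₀ ∧ (T : ℝ) ^ w ≤ m ∧ L * n₀ + k * (L * m) ≤ T ∧
          (1 - (1 - γ) / 2) ^ k * (2 * (1 / (1 - γ))) ≤ e / 2 ∧
          ∀ n : ℕ, n₀ ≤ n + 1 →
            2 * Real.exp (-(((1 - γ) / 2 * e / 4) ^ 2 * ((n : ℝ) + 1) ^ w
              / (8 * (1 / (1 - γ)) ^ 2))) ≤ d / N * (1 / ((n : ℝ) + 1) - 1 / ((n : ℝ) + 2))) := by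
  obtain ⟨C, hC1, hC⟩ := exists_const_two_mul_exp_le hw hw'
  obtain ⟨C', hC'0, hC'⟩ := exists_phase_count hw hw'
  refine ⟨4 * C + C', by linarith, ?_⟩
  intro γ N L T e d hγ0 hγ1 hN hL he0 he1 hd0 hd1 hT
  set V := 1 / (1 - γ) with hV
  set β := (1 - γ) / 2 with hβ
  have hβ0 : 0 < β := by rw [hβ]; linarith
  have hβ1 : β ≤ 1 / 2 := by rw [hβ]; linarith
  have hV1 : 1 ≤ V := by rw [hV, le_div_iff₀ (by linarith)]; linarith
  have hN2 : (2 : ℝ) ≤ N := by exact_mod_cast hN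
  have hL1 : (1 : ℝ) ≤ L := by exact_mod_cast hL
  set Λ := Real.log (N * V / (d * β * e)) with hΛ
  set R := V ^ 2 / (β ^ 2 * e ^ 2) with hR
  set l := Real.log (V / e) with hl
  have hVβe : 1 ≤ V / (β * e) := by
    rw [le_div_iff₀ (by positivity), one_mul]
    exact (mul_le_one₀ (by linarith) he0.le he1.le).trans hV1
  have hR1 : 1 ≤ R := by
    have : R = (V / (β * e)) ^ 2 := by rw [hR]; field_simp
    rw [this]
    exact one_le_pow₀ hVβe
  have hND : 1 ≤ N / d := by rw [le_div_iff₀ hd0]; linarith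
  have hZ : N * V / (d * β * e) = N / d * (V / (β * e)) := by field_simp
  have hΛ_eq : Λ = Real.log (N / d) + Real.log (V / (β * e)) := by
    rw [hΛ, hZ, Real.log_mul (by positivity) (by positivity)]
  have hlogR : Real.log R = 2 * Real.log (V / (β * e)) := by
    have : R = (V / (β * e)) ^ 2 := by rw [hR]; field_simp
    rw [this, Real.log_pow]; push_cast; ring
  have hΛ1 : 1 ≤ Λ := by
    have h1 : (4 : ℝ) ≤ N * V / (d * β * e) := by
      rw [le_div_iff₀ (by positivity)]
      have h2 : d * β ≤ 1 * (1 / 2) := mul_le_mul hd1.le hβ1 hβ0.le zero_le_one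
      have h3 : d * β * e ≤ 1 * (1 / 2) * 1 := mul_le_mul h2 he1.le he0.le (by norm_num)
      have h4 : 2 * 1 ≤ N * V := mul_le_mul hN2 hV1 zero_le_one (by linarith)
      linarith
    have h3 := Real.log_le_log (by norm_num) h1
    have h4 : Real.log 4 = 2 * Real.log 2 := by
      rw [show (4 : ℝ) = 2 ^ 2 by norm_num, Real.log_pow]; push_cast; ring
    have := Real.log_two_gt_d9
    linarith
  have hl0 : 0 ≤ l := Real.log_nonneg (by rw [le_div_iff₀ he0]; linarith)
  set Y := (R * Λ) ^ (1 / w) with hY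
  have hRΛ : 1 ≤ R * Λ := one_le_mul_of_one_le_of_one_le hR1 hΛ1
  have hY1 : 1 ≤ Y := Real.one_le_rpow hRΛ (by positivity)
  -- The burn-in needs `L` steps per visit, hence only a factor `L ^ w` inside the power, and `L ^ w
  -- ≤ L ^ (1 + 3 w)`.
  have hfirst : (L : ℝ) * Y ≤ ((L : ℝ) ^ (1 + 3 * w) * V ^ 2 * Λ / (β ^ 2 * e ^ 2)) ^ (1 / w) := by
    have h1 : (L : ℝ) = ((L : ℝ) ^ w) ^ (1 / w) := by
      rw [← Real.rpow_mul (by positivity), mul_one_div_cancel hw.ne', Real.rpow_one]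
    conv_lhs => rw [h1, hY, ← Real.mul_rpow (by positivity) (by positivity)]
    refine Real.rpow_le_rpow (by positivity) ?_ (by positivity)
    have h2 : (L : ℝ) ^ (1 + 3 * w) * V ^ 2 * Λ / (β ^ 2 * e ^ 2)
        = (L : ℝ) ^ (1 + 3 * w) * (R * Λ) := by rw [hR]; field_simp
    rw [h2]
    exact mul_le_mul_of_nonneg_right (Real.rpow_le_rpow_of_exponent_le hL1 (by linarith))
      (by positivity)
  have hsecond : 0 ≤ ((L : ℝ) / β * l) ^ (1 / (1 - w)) := by positivity
  have hq : qSteps w γ N L e d = ((L : ℝ) ^ (1 + 3 * w) * V ^ 2 * Λ / (β ^ 2 * e ^ 2)) ^ (1 / w)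
      + ((L : ℝ) / β * l) ^ (1 / (1 - w)) := rfl
  have hLY : (L : ℝ) ≤ L * Y := le_mul_of_one_le_right (by positivity) hY1
  have hLY0 : 0 ≤ (L : ℝ) * Y := by positivity
  rw [hq] at hT
  have hsum : ∀ F F' : ℝ, L * Y ≤ F → 0 ≤ F' → (4 * C + C') * (F + F') ≤ T →
      4 * C * (L * Y) ≤ T ∧ C' * F' ≤ T := by
    intro F F' h1 h2 h3
    have h4 : 4 * C * (L * Y) ≤ 4 * C * F := mul_le_mul_of_nonneg_left h1 (by linarith)
    have h5 : 0 ≤ C' * F := mul_nonneg hC'0 (hLY0.trans h1)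
    have h6 : 0 ≤ 4 * C * F' := mul_nonneg (by linarith) h2
    have h7 : 0 ≤ 4 * C * (L * Y) := mul_nonneg (by linarith) hLY0
    have h8 := mul_nonneg hC'0 h2
    constructor <;> linarith
  obtain ⟨hT1, hT2⟩ := hsum _ _ hfirst hsecond hT
  have hLT : (L : ℝ) ≤ T := by
    have : 1 * (L * Y) ≤ 4 * C * (L * Y) := mul_le_mul_of_nonneg_right (by linarith) hLY0
    linarith
  have hLT' : L ≤ T := by exact_mod_cast hLT
  refine ⟨hLT', ?_⟩
  -- For small `γ` and `e` near 1, `log (V / e)` can be arbitrarily small and the second term of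
  -- `qSteps` leaves no room for phases; there `2 γ V ≤ 2 / 7 ≤ e`, so one visit of each pair
  -- suffices. Otherwise `V / e ≥ 8 / 7`.
  by_cases hcase : γ ≤ 1 / 8 ∧ 2 / 7 ≤ e
  · left
    have h1 : γ * V ≤ 1 / 7 := by
      rw [hV, mul_one_div, div_le_iff₀ (by linarith)]
      linarith [hcase.1]
    linarith [hcase.2]
  · right
    have hVe : 8 / 7 ≤ V / e := by
      rw [le_div_iff₀ he0]
      by_cases h1 : γ ≤ 1 / 8
      · have h2 : e < 2 / 7 := by
          by_contra h
          exact hcase ⟨h1, not_lt.1 h⟩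
        linarith
      · have h2 : 8 / 7 ≤ V := by
          rw [hV, le_div_iff₀ (by linarith)]
          linarith [not_le.1 h1]
        linarith
    obtain ⟨m, k, hm, hk, hdecay⟩ := hC' V β e L T hV1 hβ0 (by linarith) he0 hVe (by omega) hT2
    have hCY : 1 ≤ C * Y := one_le_mul_of_one_le_of_one_le hC1 hY1
    -- Rounding at most doubles `C * Y`, so by the constant `4 * C` the burn-in takes at most `T /
    -- 2` steps; the phases take the other half.
    refine ⟨⌈C * Y⌉₊, m, k, Nat.ceil_pos.2 (by linarith), hm, ?_, hdecay, ?_⟩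
    · have h1 := Nat.ceil_lt_add_one (show 0 ≤ C * Y by linarith)
      have h2 : (L : ℝ) * ⌈C * Y⌉₊ ≤ L * (2 * (C * Y)) :=
        mul_le_mul_of_nonneg_left (by linarith) (by linarith)
      have h3 : (L : ℝ) * ⌈C * Y⌉₊ + k * (L * m) ≤ T := by linarith
      exact_mod_cast h3
    · intro n hn
      have h1 : C * Y ≤ (n : ℝ) + 1 := (Nat.le_ceil _).trans (by exact_mod_cast hn)
      have h2 := hC R Λ (N / d) ((n : ℝ) + 1) hR1 hΛ1 (by positivity)
        (by linarith [Real.log_nonneg hVβe]) (by linarith [Real.log_nonneg hND])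
        (by linarith) h1
      have h3 : (β * e / 4) ^ 2 * ((n : ℝ) + 1) ^ w / (8 * V ^ 2)
          = ((n : ℝ) + 1) ^ w / (128 * R) := by
        rw [hR]; field_simp; norm_num
      have h4 : (n : ℝ) + 1 + 1 = n + 2 := by ring
      rw [one_div_div, h4] at h2
      rw [h3]
      exact h2

end SampleSize

namespace Game

/-! ### The finite-time bound for Q-learning -/

section QLearningRate

variable {S A : Type*} [Fintype S] [DecidableEq S] [Lattice S]
  [Fintype A] [DecidableEq A] [Lattice A] [Nontrivial A]
  [MeasurableSpace S] [MeasurableSingletonClass S]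
  [MeasurableSpace A] [MeasurableSingletonClass A] {M : Game S A} {C₁ C₂ C₃ w : ℝ}
  {Ω : Type*} {mΩ : MeasurableSpace Ω} {Pr : Measure Ω} [IsProbabilityMeasure Pr]
  {ℱ : Filtration ℕ mΩ} {z : Ω → stdSimplex ℝ S} {pair : ℕ → Ω → S × A} {next : ℕ → Ω → S} {T : ℕ}

/-- The finite-time error bound for asynchronous Q-learning. -/
theorem IsLipschitz.measure_lt_norm_optQ_sub_qIter_le (hL : M.IsLipschitz C₁ C₂ C₃) (hw : 0 ≤ w)
    (hw' : w ≤ 1) (hz : Measurable[ℱ 0] z) (hpair : ∀ t < T, Measurable[ℱ t] (pair t))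
    (hnext : ∀ t < T, Measurable[ℱ (t + 1)] (next t))
    (hlaw : ∀ t < T, ∀ s', Pr⟦next t ⁻¹' {s'} | ℱ t⟧ =ᵐ[Pr]
      fun ω => (M.P (pair t ω).1 (pair t ω).2 (z ω)).1 s')
    {L : ℕ} {e d : ℝ} (hL1 : 1 ≤ L) (he : 0 < e) (hd : 0 ≤ d)
    (hcov : ∀ᵐ ω ∂Pr, Covers (fun t => pair t ω) T L) (hLT : L ≤ T)
    (hsteps : 2 * (M.γ * (1 / (1 - M.γ))) ≤ e ∨
        ∃ n₀ m k : ℕ, 0 < n₀ ∧ (T : ℝ) ^ w ≤ m ∧ L * n₀ + k * (L * m) ≤ T ∧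
          (1 - (1 - M.γ) / 2) ^ k * (2 * (1 / (1 - M.γ))) ≤ e / 2 ∧
          ∀ n : ℕ, n₀ ≤ n + 1 →
            2 * Real.exp (-(((1 - M.γ) / 2 * e / 4) ^ 2 * ((n : ℝ) + 1) ^ w
              / (8 * (1 / (1 - M.γ)) ^ 2))) ≤ d / ((Fintype.card S * Fintype.card A : ℕ) : ℝ)
                * (1 / ((n : ℝ) + 1) - 1 / ((n : ℝ) + 2))) :
    Pr {ω | e < ‖M.optQ (z ω)
        - M.qIter w (z ω) (fun t => pair t ω) (fun t => next t ω) T‖} ≤ ENNReal.ofReal d := by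
  rcases hsteps with hγ | ⟨n₀, m, k, hn₀, hm, hT, hk, htail⟩
  · have h1 : Pr {ω | e < ‖M.optQ (z ω)
        - M.qIter w (z ω) (fun t => pair t ω) (fun t => next t ω) T‖} = 0 := by
      rw [measure_eq_zero_iff_ae_notMem]
      filter_upwards [hcov] with ω hω h
      exact absurd (norm_optQ_sub_qIter_le_of_covers hw hω hLT hγ) (not_le.2 h)
    rw [h1]
    exact zero_le
  · have hβ : 0 < (1 - M.γ) / 2 := by linarith [M.γ_lt]
    refine le_trans (measure_mono_ae ?_) (hL.measure_noise_event_le (T := T) (n₀ := n₀)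
      hw hw' hz hpair hnext hlaw (u := (1 - M.γ) / 2 * e / 4) (by positivity) hd htail)
    filter_upwards [hcov] with ω hω h
    by_contra hne
    refine absurd (norm_optQ_sub_qIter_le hw he.le (by omega) hω hm hT hk
      fun t ht htT x => ?_) (not_le.2 h)
    by_contra hlt
    refine hne ?_
    have hv : n₀ ≤ visits (fun t => pair t ω) t x := by
      have h2 := hω.visits_add_le n₀ 0 (by omega) x
      have h3 : visits (fun t => pair t ω) (0 + L * n₀) x ≤ visits (fun t => pair t ω) t x :=
        visits_mono _ x (by omega)
      omega
    have hvT := visits_le (fun t => pair t ω) t x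
    -- The noise events are indexed by the visit number minus one; after the burn-in of `L * n₀`
    -- steps it is at least `n₀ > 0`.
    refine ⟨x, visits (fun t => pair t ω) t x - 1, by omega, by omega, ?_⟩
    rw [Nat.sub_add_cancel (by omega), ← noiseAvg_eq_sum_weight_of_le _ _ htT]
    exact (not_le.1 hlt).le

end QLearningRate

/-! ### Accuracy of Next-MF at a random mean field and strategy -/

section NextMF

variable {S A : Type*} [Fintype S] [DecidableEq S] [Lattice S] [OrderBot S]
  [Fintype A] [DecidableEq A] [Lattice A] [Nontrivial A]
  [MeasurableSpace S] [MeasurableSingletonClass S]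
  [MeasurableSpace A] [MeasurableSingletonClass A] {M : Game S A} {C₁ C₂ C₃ w : ℝ}

/-- The draws of which the rule uses `i.1`, with `i.2 s` occurrences of each next state `s`. -/
def drawsWithCounts (τ : StopRule S A) (i : ℕ × (S → ℕ)) : Set (ℕ → S × A × S) :=
  {y | τ.num y = i.1 ∧ ∀ s, ((Finset.range i.1).filter fun j => (y j).2.2 = s).card = i.2 s}

theorem measurableSet_drawsWithCounts (τ : StopRule S A) (i : ℕ × (S → ℕ)) :
    MeasurableSet (drawsWithCounts τ i) := by
  refine MeasurableSet.inter (τ.measurable_num (measurableSet_singleton i.1)) ?_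
  have h1 : {y : ℕ → S × A × S | ∀ s,
      ((Finset.range i.1).filter fun j => (y j).2.2 = s).card = i.2 s}
      = ⋂ s, {y | ((Finset.range i.1).filter fun j => (y j).2.2 = s).card = i.2 s} := by
    ext y
    simp
  change MeasurableSet {y : ℕ → S × A × S | ∀ s,
      ((Finset.range i.1).filter fun j => (y j).2.2 = s).card = i.2 s}
  rw [h1]
  refine MeasurableSet.iInter fun s => ?_
  have h2 : Measurable fun y : ℕ → S × A × S =>
      ((Finset.range i.1).filter fun j => (y j).2.2 = s).card := by
    simp only [Finset.card_filter]
    refine Finset.measurable_fun_sum _ fun j _ => Measurable.ite ?_ measurable_const measurable_const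
    exact (measurable_snd.comp (measurable_snd.comp (measurable_pi_apply j)))
      (measurableSet_singleton s)
  exact h2 (measurableSet_singleton (i.2 s))

theorem freq_of_mem_drawsWithCounts {τ : StopRule S A} {i : ℕ × (S → ℕ)} {y : ℕ → S × A × S}
    (h : y ∈ drawsWithCounts τ i) (s : S) : freq y (τ.num y) s = (i.2 s : ℝ) / i.1 := by
  rw [freq, h.1, h.2 s]

theorem pairwise_disjoint_drawsWithCounts (τ : StopRule S A) :
    Pairwise (Function.onFun Disjoint (drawsWithCounts τ)) := by
  intro i i' hi
  rw [Function.onFun, Set.disjoint_left]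
  rintro y ⟨h1, h2⟩ ⟨h1', h2'⟩
  have h3 : i.1 = i'.1 := h1.symm.trans h1'
  refine hi (Prod.ext h3 (funext fun s => ?_))
  rw [← h2 s, ← h2' s, h3]

variable {Ω : Type*} {m mΩ : MeasurableSpace Ω} {Pr : Measure Ω} [IsProbabilityMeasure Pr]
  {z : Ω → stdSimplex ℝ S} {μ : Ω → Strategy S A} {draws : Ω → ℕ → S × A × S}

theorem IsLipschitz.measurable_sum_abs_sub_Phi {Ω : Type*} {m : MeasurableSpace Ω}
    {z : Ω → stdSimplex ℝ S} {μ : Ω → Strategy S A} (hL : M.IsLipschitz C₁ C₂ C₃)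
    (hz : Measurable z) (hμ : ∀ s a, Measurable fun ω => (μ ω s).1 a) (v : S → ℝ) :
    Measurable fun ω => ∑ s, |v s - (M.Phi (z ω) (μ ω)).1 s| :=
  Finset.measurable_fun_sum _ fun s _ => (measurable_const.sub (hL.measurable_Phi hz hμ s)).abs

/-- Accuracy is assumed for fixed `z` and `μ` but needed for random ones. The draws are partitioned
into countably many cells on which the returned frequencies are constant. On each cell, being
inaccurate is an `m`-measurable condition on `z` and `μ`, so the conditional law of the draws
applies; summing the cells leaves, for each `ω`, the failure probability at the fixed values `z ω`
and `μ ω`. -/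
theorem IsLipschitz.measure_nextMF_le (hL : M.IsLipschitz C₁ C₂ C₃) (hm : m ≤ mΩ)
    (hz : Measurable[m] z) (hμ : ∀ s a, Measurable[m] fun ω => (μ ω s).1 a)
    (hdraws : Measurable[mΩ] draws)
    (hlaw : ∀ E, MeasurableSet E → Pr⟦draws ⁻¹' E | m⟧ =ᵐ[Pr]
      fun ω => (M.streamLaw (z ω) (μ ω)).real E)
    {τ : StopRule S A} {e d : ℝ} (hτ : M.NextMFAccurate τ e d) :
    Pr {ω | e < ∑ s, |freq (draws ω) (τ.num (draws ω)) s - (M.Phi (z ω) (μ ω)).1 s|}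
      ≤ ENNReal.ofReal d := by
  classical
  have hprob : ∀ ω, IsProbabilityMeasure (M.streamLaw (z ω) (μ ω)) := fun ω => by
    unfold streamLaw; infer_instance
  let E := drawsWithCounts τ
  let F : ℕ × (S → ℕ) → Set Ω := fun i =>
    {ω | e < ∑ s, |(i.2 s : ℝ) / i.1 - (M.Phi (z ω) (μ ω)).1 s|}
  have hE : ∀ i, MeasurableSet (E i) := measurableSet_drawsWithCounts τ
  have hF : ∀ i, MeasurableSet[m] (F i) := fun i =>
    hL.measurable_sum_abs_sub_Phi hz hμ (fun s => (i.2 s : ℝ) / i.1) measurableSet_Ioi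
  have hsub : {ω | e < ∑ s, |freq (draws ω) (τ.num (draws ω)) s - (M.Phi (z ω) (μ ω)).1 s|}
      ⊆ ⋃ i, draws ⁻¹' E i ∩ F i := by
    intro ω hω
    let i : ℕ × (S → ℕ) := (τ.num (draws ω), fun s =>
      ((Finset.range (τ.num (draws ω))).filter fun j => (draws ω j).2.2 = s).card)
    have hi : draws ω ∈ E i := ⟨rfl, fun s => rfl⟩
    exact Set.mem_iUnion.2 ⟨i, hi, hω⟩
  have hterm : ∀ i, Pr (draws ⁻¹' E i ∩ F i)
      = ∫⁻ ω, (F i).indicator (fun ω => M.streamLaw (z ω) (μ ω) (E i)) ω ∂Pr := by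
    intro i
    rw [measure_inter_eq_setLIntegral_of_condExp hm (hdraws (hE i)) (fun _ => measureReal_nonneg)
      (hlaw _ (hE i)) (hF i), lintegral_indicator (hm _ (hF i))]
    refine lintegral_congr fun ω => ?_
    rw [Measure.real, ENNReal.ofReal_toReal (measure_ne_top _ _)]
  have hae : ∀ i, AEMeasurable ((F i).indicator fun ω => M.streamLaw (z ω) (μ ω) (E i)) Pr := by
    intro i
    refine AEMeasurable.indicator ?_ (hm _ (hF i))
    -- Measurability in `ω` is inherited from the conditional probability, with which this function
    -- agrees almost everywhere.
    have h1 : AEMeasurable (fun ω => (M.streamLaw (z ω) (μ ω)).real (E i)) Pr :=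
      (integrable_condExp.congr (hlaw _ (hE i))).aemeasurable
    refine h1.ennreal_ofReal.congr (Eventually.of_forall fun ω => ?_)
    simp only [Measure.real]
    rw [ENNReal.ofReal_toReal (measure_ne_top _ _)]
  refine (measure_mono hsub).trans ((measure_iUnion_le _).trans ?_)
  simp only [hterm]
  rw [← lintegral_tsum hae]
  refine (lintegral_mono (g := fun _ => ENNReal.ofReal d) fun ω => ?_).trans (by simp)
  set ν := M.streamLaw (z ω) (μ ω) with hν
  let E' : ℕ × (S → ℕ) → Set (ℕ → S × A × S) := fun i => if ω ∈ F i then E i else ∅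
  have hE' : ∀ i, MeasurableSet (E' i) := fun i => by
    simp only [E']
    split_ifs
    · exact hE i
    · exact MeasurableSet.empty
  have hdisj : Pairwise (Function.onFun Disjoint E') := by
    intro i i' hi
    have h1 := pairwise_disjoint_drawsWithCounts τ hi
    simp only [Function.onFun, E'] at h1 ⊢
    split_ifs <;> first | exact h1 | simp
  have hsum : ∑' i, (F i).indicator (fun ω => M.streamLaw (z ω) (μ ω) (E i)) ω
      = ν (⋃ i, E' i) := by
    rw [measure_iUnion hdisj hE']
    refine tsum_congr fun i => ?_
    by_cases h : ω ∈ F i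
    · simp [E', h, hν]
    · simp [E', h]
  rw [hsum]
  set good : Set (ℕ → S × A × S) :=
    {y | ∑ s, |freq y (τ.num y) s - (M.Phi (z ω) (μ ω)).1 s| ≤ e} with hgood
  have h1 : 1 - d ≤ ν.real good := hτ (z ω) (μ ω)
  have h2 : Disjoint good (⋃ i, E' i) := by
    rw [Set.disjoint_left]
    intro y hy hy'
    obtain ⟨i, hi⟩ := Set.mem_iUnion.1 hy'
    by_cases h : ω ∈ F i
    · simp only [E', if_pos h] at hi
      have h3 : e < ∑ s, |(i.2 s : ℝ) / i.1 - (M.Phi (z ω) (μ ω)).1 s| := h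
      simp only [← freq_of_mem_drawsWithCounts hi] at h3
      exact absurd hy (not_le.2 h3)
    · simp [E', h] at hi
  have h3 : ν.real good + ν.real (⋃ i, E' i) ≤ 1 := by
    rw [← measureReal_union h2 (MeasurableSet.iUnion hE')]
    exact measureReal_le_one
  rw [ENNReal.le_ofReal_iff_toReal_le (measure_ne_top _ _) ?_]
  · exact (by linarith : ν.real (⋃ i, E' i) ≤ d)
  · linarith [measureReal_nonneg (μ := ν) (s := ⋃ i, E' i)]

end NextMF

/-! ### Error propagation along the outer iterations -/

section Learning

variable {S A : Type*} [Fintype S] [DecidableEq S] [Lattice S] [OrderBot S]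
  [Fintype A] [DecidableEq A] [Lattice A] [Nontrivial A]
  [MeasurableSpace S] [MeasurableSingletonClass S]
  [MeasurableSpace A] [MeasurableSingletonClass A] {M : Game S A} {C₁ C₂ C₃ w : ℝ}

/-- The power in the maximum covers `k₀ = 0`, where the geometric sum is empty. The bound keeps the
accuracy `εbar / B` in `(0, 1)`. -/
theorem IsLipschitz.one_le_constB (hL : M.IsLipschitz C₁ C₂ C₃) (k₀ : ℕ) :
    1 ≤ constB M.γ C₁ C₂ C₃ k₀ := by
  have h1 : 1 ≤ 1 + C₂ + C₃ * constD M.γ C₁ C₂ := by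
    have := mul_nonneg hL.nonneg₃ hL.constD_nonneg
    linarith [hL.nonneg₂]
  exact one_le_mul_of_one_le_of_one_le ((one_le_pow₀ h1).trans (le_max_left _ _))
    (by linarith [hL.nonneg₃])

/-- Propagation of the errors of approximate trembling best responses. -/
theorem IsLipschitz.l1dist_tbr_le (hL : M.IsLipschitz C₁ C₂ C₃) {k₀ : ℕ}
    {z : ℕ → stdSimplex ℝ S} {Q : ℕ → S → A → ℝ} {εbar : ℝ} (hε : 0 ≤ εbar)
    (h0 : z 0 = pointMass ⊥)
    (hQ : ∀ k < k₀, ‖M.optQ (z k) - Q k‖ ≤ εbar / constB M.γ C₁ C₂ C₃ k₀)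
    (hz : ∀ k < k₀, l1dist (z (k + 1)) (M.Phi (z k) (M.trembling (Q k)))
      ≤ εbar / constB M.γ C₁ C₂ C₃ k₀) : l1dist (z k₀) (M.tbr k₀) ≤ εbar := by
  set a := 1 + C₂ + C₃ * constD M.γ C₁ C₂ with ha
  set e := εbar / constB M.γ C₁ C₂ C₃ k₀ with he
  have ha0 : 0 ≤ a := by
    have := mul_nonneg hL.nonneg₃ hL.constD_nonneg
    linarith [hL.nonneg₂]
  have hB : 0 < constB M.γ C₁ C₂ C₃ k₀ := zero_lt_one.trans_le (hL.one_le_constB k₀)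
  have hC3 := hL.nonneg₃
  have he0 : 0 ≤ e := by positivity
  -- This solves `x (k + 1) ≤ a * x k + (C₃ + 1) * e` from `x 0 = 0`: the term `C₃ * e` comes from
  -- the Q-function, `e` from the sampling.
  have key : ∀ k ≤ k₀, l1dist (z k) (M.tbr k)
      ≤ (C₃ + 1) * e * ∑ j ∈ Finset.range k, a ^ j := by
    intro k
    induction k with
    | zero =>
      intro _
      rw [h0, tbr, l1dist_self]
      simp
    | succ k ih =>
      intro hk
      have h1 := ih (by omega)
      have h2 := hL.l1dist_Phi_respond_le (z k) (M.tbr k) (Q k)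
      have h3 := mul_le_mul_of_nonneg_left (hQ k (by omega)) hC3
      have h4 := hz k (by omega)
      have h5 := l1dist_triangle (z (k + 1)) (M.Phi (z k) (M.trembling (Q k))) (M.tbr (k + 1))
      have h6 := mul_le_mul_of_nonneg_left h1 ha0
      have h7 : M.tbr (k + 1) = M.respond (M.tbr k) := rfl
      rw [← h7] at h2
      have h8 : ∑ j ∈ Finset.range (k + 1), a ^ j = 1 + a * ∑ j ∈ Finset.range k, a ^ j := by
        rw [Finset.sum_range_succ', Finset.mul_sum, pow_zero, add_comm]
        simp only [pow_succ']
      rw [h8]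
      linarith
  refine (key k₀ le_rfl).trans ?_
  have h1 : (C₃ + 1) * ∑ j ∈ Finset.range k₀, a ^ j ≤ constB M.γ C₁ C₂ C₃ k₀ := by
    rw [constB, mul_comm]
    exact mul_le_mul_of_nonneg_right (le_max_right _ _) (by linarith)
  calc (C₃ + 1) * e * ∑ j ∈ Finset.range k₀, a ^ j
      = (C₃ + 1) * (∑ j ∈ Finset.range k₀, a ^ j) * e := by ring
    _ ≤ constB M.γ C₁ C₂ C₃ k₀ * e := mul_le_mul_of_nonneg_right h1 he0
    _ = εbar := by rw [he]; field_simp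

variable {Ω : Type*} [mΩ : MeasurableSpace Ω] {Pr : Measure Ω} [IsProbabilityMeasure Pr]
  {T₀ : ℕ} {τ : StopRule S A}

/-- The Q-function that Q-learning returns in iteration `k`. -/
def Run.learnedQ (R : M.Run w T₀ τ Pr) (k : ℕ) (ω : Ω) : S → A → ℝ :=
  M.qIter w (R.z k ω) (fun t => R.pair k t ω) (fun t => R.next k t ω) T₀

theorem IsLipschitz.measure_run_nextMF_le (hL : M.IsLipschitz C₁ C₂ C₃) (R : M.Run w T₀ τ Pr)
    {e d : ℝ} (hτ : M.NextMFAccurate τ e d) (k : ℕ) :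
    Pr {ω | e < l1dist (R.z (k + 1) ω) (M.Phi (R.z k ω) (M.trembling (R.learnedQ k ω)))}
      ≤ ENNReal.ofReal d := by
  have hz : Measurable[R.ℱ k T₀] (R.z k) :=
    (R.measurable_z k).mono ((R.ℱ k).mono (Nat.zero_le T₀)) le_rfl
  have hQ : ∀ s a, Measurable[R.ℱ k T₀] fun ω => R.learnedQ k ω s a :=
    hL.measurable_qIter hz
      (fun j hj => (R.measurable_pair k j hj).mono ((R.ℱ k).mono hj.le) le_rfl)
      (fun j hj => (R.measurable_next k j hj).mono ((R.ℱ k).mono hj) le_rfl)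
  have h1 := hL.measure_nextMF_le (Pr := Pr) ((R.ℱ k).le T₀) hz
    (μ := fun ω => M.trembling (R.learnedQ k ω)) (measurable_trembling hQ)
    (R.measurable_draws k) (R.draws_law k) hτ
  simp only [l1dist, R.z_succ]
  exact h1

theorem IsLipschitz.measure_run_lt_l1dist_le (hL : M.IsLipschitz C₁ C₂ C₃) (R : M.Run w T₀ τ Pr)
    {k₀ : ℕ} {εbar δ : ℝ} (hε : 0 ≤ εbar) (hδ : 0 ≤ δ)
    (hτ : M.NextMFAccurate τ (εbar / constB M.γ C₁ C₂ C₃ k₀) (δ / (2 * k₀)))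
    (hQ : ∀ k < k₀, Pr {ω | εbar / constB M.γ C₁ C₂ C₃ k₀ < ‖M.optQ (R.z k ω) - R.learnedQ k ω‖}
      ≤ ENNReal.ofReal (δ / (2 * k₀))) :
    Pr {ω | εbar < l1dist (R.z k₀ ω) (M.tbr k₀)} ≤ ENNReal.ofReal δ := by
  set e := εbar / constB M.γ C₁ C₂ C₃ k₀
  -- Iteration `k` fails through its Q-function or its sampling. Outside all bad events the
  -- propagation of errors is deterministic.
  set bad : ℕ → Set Ω := fun k => {ω | e < ‖M.optQ (R.z k ω) - R.learnedQ k ω‖}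
    ∪ {ω | e < l1dist (R.z (k + 1) ω) (M.Phi (R.z k ω) (M.trembling (R.learnedQ k ω)))}
  have hsub : {ω | εbar < l1dist (R.z k₀ ω) (M.tbr k₀)} ⊆ ⋃ k ∈ Finset.range k₀, bad k := by
    intro ω hω
    by_contra hne
    simp only [Set.mem_iUnion, Finset.mem_range, not_exists] at hne
    have hne' : ∀ k < k₀, ¬ e < ‖M.optQ (R.z k ω) - R.learnedQ k ω‖ ∧
        ¬ e < l1dist (R.z (k + 1) ω) (M.Phi (R.z k ω) (M.trembling (R.learnedQ k ω))) :=
      fun k hk => not_or.1 (hne k hk)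
    exact absurd (hL.l1dist_tbr_le (z := fun k => R.z k ω) (Q := fun k => R.learnedQ k ω) hε
      (R.z_zero ω) (fun k hk => not_lt.1 (hne' k hk).1) fun k hk => not_lt.1 (hne' k hk).2)
      (not_le.2 hω)
  refine (measure_mono hsub).trans ((measure_biUnion_finset_le _ _).trans ?_)
  have hbad : ∀ k ∈ Finset.range k₀, Pr (bad k) ≤ ENNReal.ofReal (δ / k₀) := by
    intro k hk
    refine (measure_union_le _ _).trans ((add_le_add (hQ k (Finset.mem_range.1 hk))
      (hL.measure_run_nextMF_le R hτ k)).trans_eq ?_)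
    rw [← ENNReal.ofReal_add (by positivity) (by positivity)]
    congr 1
    field_simp
    norm_num
  refine (Finset.sum_le_sum hbad).trans ?_
  rw [Finset.sum_const, Finset.card_range, nsmul_eq_mul, ← ENNReal.ofReal_natCast,
    ← ENNReal.ofReal_mul (by positivity)]
  refine ENNReal.ofReal_le_ofReal ?_
  rcases Nat.eq_zero_or_pos k₀ with h | h
  · simpa [h] using hδ
  · exact (mul_div_cancel₀ δ (by positivity)).le

end Learning

end Game

end MFG

end

/-! ### The main theorem -/

theorem mainTheorem3 (w : ℝ) (hw : 1 / 2 < w) (hw' : w < 1) :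
    ∃ c : ℝ, 0 < c ∧
      ∀ (S A : Type*) [Fintype S] [DecidableEq S] [Lattice S] [OrderBot S]
        [MeasurableSpace S] [MeasurableSingletonClass S]
        [Fintype A] [DecidableEq A] [Lattice A] [Nontrivial A]
        [MeasurableSpace A] [MeasurableSingletonClass A]
        (M : MFG.Game S A) (C₁ C₂ C₃ : ℝ),
        M.IsSC → M.IsLipschitz C₁ C₂ C₃ →
        ∃ zstar : stdSimplex ℝ S,
          M.IsTMFE zstar (M.trembling (M.optQ zstar)) ∧
          Tendsto M.tbr atTop (𝓝 zstar) ∧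
          ∀ (εbar δ : ℝ) (k₀ L T₀ : ℕ) (τ : MFG.StopRule S A),
            0 < εbar → εbar < 1 → 0 < δ → δ < 1 →
            MFG.l1dist (M.tbr k₀) zstar ≤ εbar →
            M.NextMFAccurate τ (εbar / MFG.constB M.γ C₁ C₂ C₃ k₀) (δ / (2 * k₀)) →
            c * MFG.qSteps w M.γ (Fintype.card S * Fintype.card A) L
              (εbar / MFG.constB M.γ C₁ C₂ C₃ k₀) (δ / (2 * k₀)) ≤ T₀ →
            ∀ (Ω : Type*) [MeasurableSpace Ω] (Pr : Measure Ω) [IsProbabilityMeasure Pr]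
              (R : M.Run w T₀ τ Pr),
              (∀ k < k₀, R.CoveredWithin k L) →
              1 - δ ≤ Pr.real {ω | MFG.l1dist (R.z k₀ ω) zstar ≤ 2 * εbar} := by
  have hw0 : 0 < w := by linarith
  obtain ⟨c, hc0, hc⟩ := MFG.exists_const_qSteps hw0 hw'
  refine ⟨c, hc0, ?_⟩
  intro S A _ _ _ _ _ _ _ _ _ _ _ _ M C₁ C₂ C₃ hSC hL
  obtain ⟨zstar, hz⟩ := hSC.exists_tendsto_tbr
  refine ⟨zstar, hL.isTMFE_of_tendsto hz, hz, ?_⟩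
  intro εbar δ k₀ L T₀ τ hε0 hε1 hδ0 hδ1 hk₀ hτ hT Ω _ Pr _ R hcov
  have hB := hL.one_le_constB k₀
  set e := εbar / MFG.constB M.γ C₁ C₂ C₃ k₀ with he
  have he0 : 0 < e := by positivity
  have he1 : e < 1 := by
    rw [he, div_lt_one (by linarith)]
    linarith
  have hQ : ∀ k < k₀, Pr {ω | e < ‖M.optQ (R.z k ω) - R.learnedQ k ω‖}
      ≤ ENNReal.ofReal (δ / (2 * k₀)) := by
    intro k hk
    have hk₀1 : (1 : ℝ) ≤ k₀ := by exact_mod_cast (show 1 ≤ k₀ by omega)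
    have hd0 : 0 < δ / (2 * k₀) := by positivity
    have hd1 : δ / (2 * k₀) < 1 := by
      rw [div_lt_one (by positivity)]
      linarith
    have hN : 2 ≤ Fintype.card S * Fintype.card A := by
      have h1 : 1 ≤ Fintype.card S := Fintype.card_pos_iff.2 ⟨⊥⟩
      have h2 : 1 < Fintype.card A := Fintype.one_lt_card
      nlinarith
    -- A window of length zero contains no visit, so covering rules out `L = 0`.
    have hL1 : 1 ≤ L := by
      by_contra h
      obtain ⟨ω, hω⟩ := (hcov k hk).exists
      obtain ⟨a⟩ : Nonempty A := inferInstance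
      obtain ⟨j, h1, h2, -⟩ := hω 0 (by omega) (⊥, a)
      omega
    obtain ⟨hLT, hsteps⟩ := hc M.γ _ L T₀ e _ M.γ_nonneg M.γ_lt hN hL1 he0 he1 hd0 hd1 hT
    exact hL.measure_lt_norm_optQ_sub_qIter_le hw0.le hw'.le (R.measurable_z k)
      (R.measurable_pair k) (R.measurable_next k) (R.next_law k) hL1 he0 hd0.le (hcov k hk) hLT
      hsteps
  have h1 := hL.measure_run_lt_l1dist_le R hε0.le hδ0.le hτ hQ
  have h2 : {ω | MFG.l1dist (R.z k₀ ω) zstar ≤ 2 * εbar}ᶜ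
      ⊆ {ω | εbar < MFG.l1dist (R.z k₀ ω) (M.tbr k₀)} := by
    intro ω hω
    by_contra h
    refine hω ?_
    have h3 : MFG.l1dist (R.z k₀ ω) (M.tbr k₀) ≤ εbar := not_lt.1 h
    have h4 := MFG.l1dist_triangle (R.z k₀ ω) (M.tbr k₀) zstar
    exact (by linarith : MFG.l1dist (R.z k₀ ω) zstar ≤ 2 * εbar)
  have h5 : Pr.real {ω | MFG.l1dist (R.z k₀ ω) zstar ≤ 2 * εbar}ᶜ ≤ δ :=
    ENNReal.toReal_le_of_le_ofReal hδ0.le ((measure_mono h2).trans h1)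
  -- Subadditivity suffices to pass to the complement and does not require the event to be
  -- measurable.
  have h6 := measureReal_union_le (μ := Pr) {ω | MFG.l1dist (R.z k₀ ω) zstar ≤ 2 * εbar}
    {ω | MFG.l1dist (R.z k₀ ω) zstar ≤ 2 * εbar}ᶜ
  rw [Set.union_compl_self, probReal_univ] at h6
  linarith
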